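/- Conventions. Let $d\ge 1$. A lattice in $\mathbb R^d$ is a discrete additive subgroup of rank $d$; a sublattice of a lattice $\Lambda$ is a lattice $\Phi\subseteq\Lambda$. A fundamental domain $\Omega_\Phi$ of $\Phi$ is a subset of $\mathbb R^d$ containing exactly one point of each coset $x+\Phi$. All configurations are multisets. For $F:\mathbb R^d\to[0,\infty]$ and an $n$-point configuration $\omega=\{x_1,\dots,x_n\}\subset\mathbb R^d$ put $E_F(\omega)=\sum_{i}\sum_{j\ne i}F(x_i-x_j)$; $\omega$ is $F$-optimal if $E_F(\omega)$ is minimal among all $n$-point configurations in $\mathbb R^d$. A function $f:[0,\infty)\to[0,\infty]$ has $d$-rapid decay if $f(r^2)=O(r^{-s})$ as $r\to\infty$ for some $s>d$. Put $F_{f,\Phi}(x)=\sum_{v\in\Phi}f(|x+v|^2)$. An infinite configuration $C$ is an infinite multiset in $\mathbb R^d$ with finitely many points in each ball. With $C_r=C\cap B(0,r)$, its density is $\lim_{r\to\infty}|C_r|/\mathrm{Vol}(B(0,r))$ (if this limit exists and is finite), and its lower $f$-energy is $E^l_f(C)=\liminf_{r\to\infty}E_f(C_r)/|C_r|$, where $E_f$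 is the energy for the potential $x\mapsto f(|x|^2)$; if the limit exists in $[0,\infty]$ it is written $E_f(C)$. An infinite configuration $C'$ of density $\rho$ is $f$-optimal if $E_f(C')$ exists and $E_f(C')\le E_f^l(C)$ for every infinite configuration $C$ of density $\rho$. Proposition. Let $\Lambda\subset\mathbb R^d$ be a lattice of density $\rho>0$. (A) Let $f:[0,\infty)\to[0,\infty]$ be lower semicontinuous and of $d$-rapid decay, and suppose that some infinite configuration of density strictly larger than $\rho$ has finite lower $f$-energy (this holds whenever $f$ is finite on $(0,\infty)$, for instance with the configuration $\tfrac12\Lambda$). Then the following are equivalent: (1) $\Lambda$, as an infinite configuration of density $\rho$, is $f$-optimal. (2) For every sublattice $\Phi\subseteq\Lambda$ (and every choice of $\Omega_\Phi$), $\Lambda\cap\Omega_\Phi$ is $F_{f,\Phi}$-optimal. (3) There is a sublattice $\Phi\subseteq\Lambda$ such that $\Lambda\cap\Omega_{m\Phi}$ is $F_{f,m\Phi}$-optimal (for every choice of $\Omega_{m\Phi}$) for infinitely many positive integers $m$. (B) Consequently, writing $f_a(t)=e^{-at}$: for every sublattice $\Phi\subseteq\Lambda$ the configuration $\Lambda\cap\Omega_\Phi$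 is $F_{f_a,\Phi}$-optimal for all $a>0$ (periodic universal optimality of $\Lambda$) if and only if $\Lambda$, as an infinite configuration of density $\rho$, is $f_a$-optimal for all $a>0$ (universal optimality in the sense of Cohn and Kumar). -/

import Mathlib

open Filter Topology MeasureTheory
open scoped NNReal ENNReal Pointwise

/-- The `d`-dimensional Euclidean space. -/
abbrev Euc (d : ℕ) : Type := EuclideanSpace ℝ (Fin d)

/-- The `F`-energy `∑_{i} ∑_{j ≠ i} F (x i - x j)` of a configuration (multiset of points), given
as a family of points indexed by `ι`; the sums are taken in `[0, ∞]`. -/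
noncomputable def configEnergy {d : ℕ} (F : Euc d → ℝ≥0∞) {ι : Type} (x : ι → Euc d) : ℝ≥0∞ :=
  ∑' i : ι, ∑' j : {j : ι // j ≠ i}, F (x i - x j)

/-- The minimal discrete `n`-point `F`-energy. -/
noncomputable def minEnergy {d : ℕ} (F : Euc d → ℝ≥0∞) (n : ℕ) : ℝ≥0∞ :=
  ⨅ y : Fin n → Euc d, configEnergy F y

/-- A finite configuration is `F`-optimal if it attains the minimal energy among all
configurations with the same number of points. -/
def IsEnergyOptimal {d : ℕ} (F : Euc d → ℝ≥0∞) {ι : Type} (x : ι → Euc d) : Prop :=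
  Finite ι ∧ configEnergy F x = minEnergy F (Nat.card ι)

/-- `f : [0, ∞) → [0, ∞]` has `d`-rapid decay: `f (r ^ 2) = O(r ^ (-s))` as `r → ∞`, for some
`s > d`. -/
def HasRapidDecay (d : ℕ) (f : ℝ≥0 → ℝ≥0∞) : Prop :=
  ∃ s : ℝ, (d : ℝ) < s ∧ ∃ K : ℝ≥0, ∀ᶠ r : ℝ≥0 in atTop,
    f (r ^ 2) ≤ ((K * r ^ (-s) : ℝ≥0) : ℝ≥0∞)

/-- The function `x ↦ f (|x| ^ 2)` on `ℝ ^ d`. -/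
noncomputable def radialPotential {d : ℕ} (f : ℝ≥0 → ℝ≥0∞) (x : Euc d) : ℝ≥0∞ :=
  f (‖x‖₊ ^ 2)

/-- The periodized potential `F_{f,Φ}(x) = ∑_{v ∈ Φ} f (|x + v| ^ 2)`. -/
noncomputable def periodizedPotential {d : ℕ} (f : ℝ≥0 → ℝ≥0∞) (Φ : Submodule ℤ (Euc d))
    (x : Euc d) : ℝ≥0∞ :=
  ∑' v : Φ, f (‖x + (v : Euc d)‖₊ ^ 2)

/-- `Φ` is a sublattice of `Λ`: a subgroup of `Λ` which is itself a lattice (discrete and of full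
rank) in `ℝ ^ d`. -/
def IsSubZLattice {d : ℕ} (Φ Λ : Submodule ℤ (Euc d)) : Prop :=
  Φ ≤ Λ ∧ ∃ _ : DiscreteTopology Φ, IsZLattice ℝ Φ

/-- `Ω` is a fundamental domain for the translation action of `Φ` on `ℝ ^ d`: it contains exactly
one point of each orbit. -/
def IsFundDomain {d : ℕ} (Φ : Submodule ℤ (Euc d)) (Ω : Set (Euc d)) : Prop :=
  ∀ x : Euc d, ∃! v : Φ, x + (v : Euc d) ∈ Ω

/-- The configuration `Λ ∩ Ω_Φ` is `F_{f,Φ}`-optimal, for every choice of the fundamental domain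
`Ω_Φ`. -/
def IsPeriodicOptimal {d : ℕ} (f : ℝ≥0 → ℝ≥0∞) (Λ Φ : Submodule ℤ (Euc d)) : Prop :=
  ∀ Ω : Set (Euc d), IsFundDomain Φ Ω →
    IsEnergyOptimal (periodizedPotential f Φ)
      (fun x : ↥((Λ : Set (Euc d)) ∩ Ω) => (x : Euc d))

/-- An infinite configuration: an infinite multiset of points (a family of points indexed by an
infinite type) such that every ball contains only finitely many of them. -/
def IsInfiniteConfig {d : ℕ} {ι : Type} (x : ι → Euc d) : Prop :=
  Infinite ι ∧ ∀ (c : Euc d) (r : ℝ), {i : ι | x i ∈ Metric.ball c r}.Finite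

/-- The part `C_r` of a configuration that lies in the ball of radius `r` around the origin. -/
def restrictBall {d : ℕ} {ι : Type} (x : ι → Euc d) (r : ℝ) :
    {i : ι // x i ∈ Metric.ball (0 : Euc d) r} → Euc d :=
  fun i => x i

/-- The configuration `x` has density `ρ`. -/
def HasDensity {d : ℕ} {ι : Type} (x : ι → Euc d) (ρ : ℝ) : Prop :=
  Tendsto (fun r : ℝ => (Nat.card {i : ι // x i ∈ Metric.ball (0 : Euc d) r} : ℝ) /
    (volume (Metric.ball (0 : Euc d) r)).toReal) atTop (𝓝 ρ)

/-- The energy per point `E_f(C_r) / |C_r|` of the part of a configuration in the ball of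
radius `r`. -/
noncomputable def energyPerPoint {d : ℕ} (f : ℝ≥0 → ℝ≥0∞) {ι : Type} (x : ι → Euc d) (r : ℝ) :
    ℝ≥0∞ :=
  configEnergy (radialPotential f) (restrictBall x r) /
    (Nat.card {i : ι // x i ∈ Metric.ball (0 : Euc d) r} : ℝ≥0∞)

/-- The lower `f`-energy of an infinite configuration. -/
noncomputable def lowerEnergy {d : ℕ} (f : ℝ≥0 → ℝ≥0∞) {ι : Type} (x : ι → Euc d) : ℝ≥0∞ :=
  liminf (fun r : ℝ => energyPerPoint f x r) atTop

/-- The infinite configuration `x` has density `ρ`, its average `f`-energy exists (as a limit), and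
this average energy is at most the lower `f`-energy of every infinite configuration of
density `ρ`. -/
def IsOptimalOfDensity {d : ℕ} (f : ℝ≥0 → ℝ≥0∞) (ρ : ℝ) {ι : Type} (x : ι → Euc d) : Prop :=
  IsInfiniteConfig x ∧ HasDensity x ρ ∧
    ∃ e : ℝ≥0∞, Tendsto (fun r : ℝ => energyPerPoint f x r) atTop (𝓝 e) ∧
      ∀ (κ : Type) (y : κ → Euc d), IsInfiniteConfig y → HasDensity y ρ → e ≤ lowerEnergy f y

/-- The points of `Λ`, each with multiplicity one, as a configuration. -/
def latticeConfig {d : ℕ} (Λ : Submodule ℤ (Euc d)) : Λ → Euc d := fun v => v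

/-- The Gaussian `f_a(r ^ 2) = exp (-a r ^ 2)`. -/
noncomputable def gaussianPotential (a : ℝ) (t : ℝ≥0) : ℝ≥0∞ :=
  ENNReal.ofReal (Real.exp (-a * (t : ℝ)))

/-- A lattice is universally optimal in the periodic sense if for every sublattice `Φ` the
configuration `Λ ∩ Ω_Φ` is `F_{a,Φ}`-optimal for all `a > 0`. -/
def IsPeriodicUniversallyOptimal {d : ℕ} (Λ : Submodule ℤ (Euc d)) : Prop :=
  ∀ Φ : Submodule ℤ (Euc d), IsSubZLattice Φ Λ →
    ∀ a : ℝ, 0 < a → IsPeriodicOptimal (gaussianPotential a) Λ Φ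

/-- Universal optimality of an infinite configuration of density `ρ`. -/
def IsUniversallyOptimalOfDensity {d : ℕ} (ρ : ℝ) {ι : Type} (x : ι → Euc d) : Prop :=
  ∀ a : ℝ, 0 < a → IsOptimalOfDensity (gaussianPotential a) ρ x

/-!
Both kinds of optimality of a lattice `Λ` are compared with its average energy
`latticeSum f Λ = ∑ f (|v| ^ 2)`, the sum being over the nonzero `v ∈ Λ`. It is the limit of the
energy per point (`tendsto_energyPerPoint_latticeConfig`), and for every fundamental domain `Ω` of
`Φ ⊆ Λ` the energy of `Λ ∩ Ω` per point is the part of the sum over `v ∉ Φ`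
(`configEnergy_inter_fundDomain`).

*Optimality in space implies optimality on tori.* A competitor `y` on the torus `ℝ ^ d / Φ` lifts to
the periodic configuration `y + Φ`, of the same density as `Λ`, and its average energy exceeds the
torus energy per point by the same constant `latticeSum f Φ` as for `Λ`
(`lowerEnergy_periodicConfig_le`). This constant can be cancelled when it is finite, which is where a
configuration of larger density with finite energy is needed (`IsOptimalOfDensity.latticeSum_ne_top`).

*Optimality on the tori `ℝ ^ d / mΦ` implies optimality in space.* It has to be shown that a
configuration `C` of the density of `Λ` and of lower energy below `L` yields, for large `m`, a
configuration on `ℝ ^ d / mΦ` with exactly as many points as `Λ` and energy at most `L` per point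
(`eventually_minEnergy_le`). A large ball of `C` is cut into boxes of a fixed size `ℓ`, and the
points near the boundaries of the boxes are discarded; a pigeonhole argument over translates of the
tiling shows that few points are lost (`hasCellFamily_of_lowerEnergy_lt`). Points of distinct boxes
are then at a distance of order `ℓ`, so that by rapid decay their interaction is summable with total
`O(ℓ ^ (-s))` (`exists_interaction_bound`). The boxes are used as building blocks for a
configuration on the torus. The numbers of points in single boxes are not under control, only their
average is; but for a random arrangement of the blocks the expected interaction of two blocks is
governed by the average number of points, which is `O(ℓ ^ d)`
(`exists_perm_interaction_le`, `exists_assembly`). As `d < s`, the interaction between blocks is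
negligible for large `ℓ`. Finally the number of points has to be right. Removing points does not
increase the energy, and the points lost in the gaps are compensated for by using a small proportion
of blocks cut from a configuration of larger density and finite energy (`HasCellFamily.mix`).
-/

/-! ### Energies of configurations -/

theorem configEnergy_eq {d : ℕ} (F : Euc d → ℝ≥0∞) {ι : Type} [DecidableEq ι] (x : ι → Euc d) :
    configEnergy F x = ∑' i, ∑' j, if j = i then 0 else F (x i - x j) := by
  refine tsum_congr fun i => ?_
  refine (tsum_subtype {j | j ≠ i} fun j => F (x i - x j)).trans (tsum_congr fun j => ?_)
  by_cases h : j = i <;> simp [h]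

theorem configEnergy_comp_le {d : ℕ} (F : Euc d → ℝ≥0∞) {ι κ : Type} (x : ι → Euc d)
    {e : κ → ι} (he : Function.Injective e) :
    configEnergy F (x ∘ e) ≤ configEnergy F x := by
  classical
  rw [configEnergy_eq, configEnergy_eq]
  refine le_trans ?_ (ENNReal.tsum_comp_le_tsum_of_injective he _)
  refine ENNReal.tsum_le_tsum fun k => ?_
  refine le_trans (le_of_eq ?_) (ENNReal.tsum_comp_le_tsum_of_injective he _)
  simp [he.eq_iff]

theorem configEnergy_add_const {d : ℕ} (F : Euc d → ℝ≥0∞) {ι : Type} (x : ι → Euc d)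
    (c : Euc d) : configEnergy F (fun i => x i + c) = configEnergy F x := by
  simp [configEnergy]

/-- The energy of a union of configurations is the sum of their energies and of the mutual
interaction energies. -/
theorem configEnergy_sigma {d : ℕ} (F : Euc d → ℝ≥0∞) {J : Type} {I : J → Type} [DecidableEq J]
    (X : ∀ j, I j → Euc d) :
    configEnergy F (fun p : Σ j, I j => X p.1 p.2) = ∑' j, configEnergy F (X j) +
      ∑' j, ∑' j', if j' = j then 0 else ∑' i : I j, ∑' i' : I j', F (X j i - X j' i') := by
  classical
  simp_rw [configEnergy_eq]
  rw [ENNReal.tsum_sigma', ← ENNReal.tsum_add]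
  refine tsum_congr fun j => ?_
  have h : ∀ i : I j, (∑' p : Σ j, I j, if p = ⟨j, i⟩ then 0 else F (X j i - X p.1 p.2)) =
      (∑' i' : I j, if i' = i then 0 else F (X j i - X j i')) +
        ∑' j', if j' = j then 0 else ∑' i' : I j', F (X j i - X j' i') := by
    intro i
    rw [ENNReal.tsum_sigma', ENNReal.tsum_eq_add_tsum_ite j]
    congr 1
    · refine tsum_congr fun i' => ?_
      simp
    · refine tsum_congr fun j' => ?_
      by_cases hj : j' = j
      · simp [hj]
      · simp [hj]
  simp_rw [h]
  rw [ENNReal.tsum_add]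
  congr 1
  rw [ENNReal.tsum_comm]
  refine tsum_congr fun j' => ?_
  by_cases hj : j' = j <;> simp [hj]

theorem sum_configEnergy_le_configEnergy_sigma {d : ℕ} (F : Euc d → ℝ≥0∞) {J : Type}
    {I : J → Type} (X : ∀ j, I j → Euc d) :
    ∑' j, configEnergy F (X j) ≤ configEnergy F (fun p : Σ j, I j => X p.1 p.2) := by
  classical
  rw [configEnergy_sigma]
  exact le_self_add

/-- Deleting points does not increase the energy. -/
theorem minEnergy_le_configEnergy {d : ℕ} (F : Euc d → ℝ≥0∞) {ι : Type} [Fintype ι]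
    (x : ι → Euc d) {n : ℕ} (hn : n ≤ Fintype.card ι) : minEnergy F n ≤ configEnergy F x := by
  obtain ⟨e⟩ := Function.Embedding.nonempty_of_card_le (α := Fin n) (β := ι) (by simpa using hn)
  exact (iInf_le _ _).trans (configEnergy_comp_le F x e.injective)

/-- The energy of a periodized potential is the energy of the original potential plus the
interactions with the translates by nonzero vectors; here those are bounded by `w`. -/
theorem configEnergy_periodized_le {d : ℕ} (f : ℝ≥0 → ℝ≥0∞) (Φ : Submodule ℤ (Euc d))
    {ι : Type} [Fintype ι] (x : ι → Euc d) (w : ℝ≥0∞)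
    (hw : ∀ i j, ∑' v : Φ, (if v = 0 then 0 else radialPotential f (x i - x j + (v : Euc d))) ≤ w) :
    configEnergy (periodizedPotential f Φ) x ≤
      configEnergy (radialPotential f) x + (Fintype.card ι : ℝ≥0∞) ^ 2 * w := by
  classical
  have key : ∀ i j, periodizedPotential f Φ (x i - x j) ≤ radialPotential f (x i - x j) + w := by
    intro i j
    rw [periodizedPotential, ENNReal.tsum_eq_add_tsum_ite (0 : Φ)]
    refine add_le_add (by simp [radialPotential]) (le_trans (le_of_eq ?_) (hw i j))
    refine tsum_congr fun v => ?_
    by_cases h : v = 0 <;> simp [h, radialPotential]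
  rw [configEnergy_eq, configEnergy_eq]
  calc _ ≤ ∑' i, ∑' j, ((if j = i then 0 else radialPotential f (x i - x j)) + w) := by
        refine ENNReal.tsum_le_tsum fun i => ENNReal.tsum_le_tsum fun j => ?_
        split_ifs
        · simp
        · exact key i j
    _ = _ := by
        simp_rw [ENNReal.tsum_add]
        simp [tsum_fintype, sq, mul_assoc]

/-! ### Averaging over arrangements -/

/-- For a uniformly random permutation `σ`, the expectation of `n (σ z) * n (σ z')` is at most
`(∑ y, n y) ^ 2 / (c * (c - 1))`, where `c` is the number of sites. -/
theorem sum_perm_mul {Z : Type} [Fintype Z] [DecidableEq Z] (n : Z → ℝ≥0∞) (z z' : Z)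
    (h : z ≠ z') :
    ((Fintype.card Z * (Fintype.card Z - 1) : ℕ) : ℝ≥0∞) *
        ∑ σ : Equiv.Perm Z, n (σ z) * n (σ z') ≤
      (Fintype.card (Equiv.Perm Z) : ℝ≥0∞) * (∑ y, n y) ^ 2 := by
  -- by 2-transitivity the sum is the same for all pairs of distinct points
  have inv : ∀ y y' : Z, y ≠ y' → ∑ σ : Equiv.Perm Z, n (σ y) * n (σ y') =
      ∑ σ : Equiv.Perm Z, n (σ z) * n (σ z') := by
    intro y y' hy
    obtain ⟨τ, h1, h2⟩ : ∃ τ : Equiv.Perm Z, τ y = z ∧ τ y' = z' := by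
      refine ⟨(Equiv.swap y z).trans (Equiv.swap (Equiv.swap y z y') z'), ?_, ?_⟩
      · simp only [Equiv.trans_apply, Equiv.swap_apply_left]
        refine Equiv.swap_apply_of_ne_of_ne ?_ h
        intro h3
        have : Equiv.swap y z y = Equiv.swap y z y' := by simpa using h3
        exact hy ((Equiv.swap y z).injective this)
      · simp
    refine Fintype.sum_equiv (Equiv.mulRight τ⁻¹) _ _ fun σ => ?_
    simp [← h1, ← h2]
  have cardeq : (Fintype.card Z * (Fintype.card Z - 1) : ℕ) =
      (Finset.univ : Finset Z).offDiag.card := by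
    rw [Finset.offDiag_card, Finset.card_univ, Nat.mul_sub_one]
  rw [cardeq, ← nsmul_eq_mul, ← Finset.sum_const]
  calc _ = ∑ p ∈ (Finset.univ : Finset Z).offDiag, ∑ σ : Equiv.Perm Z, n (σ p.1) * n (σ p.2) := by
        refine Finset.sum_congr rfl fun p hp => (inv p.1 p.2 ?_).symm
        simpa using hp
    _ = ∑ σ : Equiv.Perm Z, ∑ p ∈ (Finset.univ : Finset Z).offDiag, n (σ p.1) * n (σ p.2) :=
        Finset.sum_comm
    _ ≤ ∑ σ : Equiv.Perm Z, ∑ p : Z × Z, n (σ p.1) * n (σ p.2) :=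
        Finset.sum_le_sum fun σ _ => Finset.sum_le_sum_of_subset (Finset.subset_univ _)
    _ = ∑ σ : Equiv.Perm Z, (∑ y, n y) ^ 2 := by
        refine Finset.sum_congr rfl fun σ _ => ?_
        rw [Fintype.sum_prod_type, ← Equiv.sum_comp σ n, sq, Finset.sum_mul_sum]
    _ = _ := by simp

/-- If boxes with contents `n` are placed at sites `Z` with interactions `w`, some arrangement has
at most the interaction energy that the averaged contents would have. -/
theorem exists_perm_interaction_le {Z : Type} [Fintype Z] [DecidableEq Z] [Nontrivial Z]
    (n : Z → ℝ≥0∞) (w : Z → Z → ℝ≥0∞) (B : ℝ≥0∞) (hB : ∀ z, ∑ z', w z z' ≤ B) :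
    ∃ σ : Equiv.Perm Z,
      ((Fintype.card Z - 1 : ℕ) : ℝ≥0∞) *
        (∑ z, ∑ z', if z' = z then 0 else n (σ z) * n (σ z') * w z z') ≤ (∑ y, n y) ^ 2 * B := by
  set c := Fintype.card Z
  have hc : (c : ℝ≥0∞) ≠ 0 := by simp [c]
  suffices h : ∑ σ : Equiv.Perm Z, ((c - 1 : ℕ) : ℝ≥0∞) *
      (∑ z, ∑ z', if z' = z then 0 else n (σ z) * n (σ z') * w z z') ≤
      ∑ σ : Equiv.Perm Z, (∑ y, n y) ^ 2 * B by
    by_contra! hlt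
    exact h.not_gt (ENNReal.sum_lt_sum_of_nonempty Finset.univ_nonempty fun σ _ => hlt σ)
  rw [← ENNReal.mul_le_mul_iff_right hc (by simp)]
  calc (c : ℝ≥0∞) * ∑ σ : Equiv.Perm Z, ((c - 1 : ℕ) : ℝ≥0∞) *
      (∑ z, ∑ z', if z' = z then 0 else n (σ z) * n (σ z') * w z z')
      = ∑ z, ∑ z', if z' = z then 0 else
          (((c * (c - 1) : ℕ) : ℝ≥0∞) * ∑ σ : Equiv.Perm Z, n (σ z) * n (σ z')) * w z z' := by
        rw [← Finset.mul_sum, ← mul_assoc, ← Nat.cast_mul, Finset.sum_comm, Finset.mul_sum]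
        refine Finset.sum_congr rfl fun z _ => ?_
        rw [Finset.sum_comm, Finset.mul_sum]
        refine Finset.sum_congr rfl fun z' _ => ?_
        split_ifs
        · simp
        · rw [mul_assoc, Finset.sum_mul]
    _ ≤ ∑ z, ∑ z', ((Fintype.card (Equiv.Perm Z) : ℝ≥0∞) * (∑ y, n y) ^ 2) * w z z' := by
        refine Finset.sum_le_sum fun z _ => Finset.sum_le_sum fun z' _ => ?_
        split_ifs with h
        · exact zero_le
        · exact mul_le_mul_left (sum_perm_mul n z z' (Ne.symm h)) _
    _ ≤ ∑ z : Z, ((Fintype.card (Equiv.Perm Z) : ℝ≥0∞) * (∑ y, n y) ^ 2) * B := by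
        refine Finset.sum_le_sum fun z _ => ?_
        rw [← Finset.mul_sum]
        exact mul_le_mul_right (hB z) _
    _ = _ := by
        simp only [Finset.sum_const, Finset.card_univ, nsmul_eq_mul]
        ring

/-! ### Counting points in balls -/

/-- The number `|C_r|` of points of a configuration in the ball of radius `r` around the origin. -/
noncomputable def ballCount {d : ℕ} {ι : Type} (x : ι → Euc d) (r : ℝ) : ℕ :=
  Nat.card {i : ι // x i ∈ Metric.ball (0 : Euc d) r}

theorem IsInfiniteConfig.finite_ball {d : ℕ} {ι : Type} {x : ι → Euc d} (hx : IsInfiniteConfig x)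
    (r : ℝ) : Finite {i : ι // x i ∈ Metric.ball (0 : Euc d) r} :=
  (hx.2 0 r).to_subtype

theorem tendsto_volume_ball_add_div {d : ℕ} (c : ℝ) :
    Tendsto (fun r : ℝ => (volume (Metric.ball (0 : Euc d) (r + c))).toReal /
      (volume (Metric.ball (0 : Euc d) r)).toReal) atTop (𝓝 1) := by
  have h1 : Tendsto (fun r : ℝ => (1 + c / r) ^ d) atTop (𝓝 1) := by
    have : Tendsto (fun r : ℝ => c / r) atTop (𝓝 0) := tendsto_const_nhds.div_atTop tendsto_id
    simpa using (this.const_add 1).pow d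
  refine h1.congr' ?_
  filter_upwards [eventually_gt_atTop 0, eventually_gt_atTop (-c)] with r hr hrc
  have hV : (volume (Metric.ball (0 : Euc d) 1)).toReal ≠ 0 :=
    (ENNReal.toReal_pos (Metric.measure_ball_pos _ _ one_pos).ne' measure_ball_lt_top.ne).ne'
  rw [Measure.addHaar_ball_of_pos _ _ hr, Measure.addHaar_ball_of_pos _ _ (by linarith : 0 < r + c),
    ENNReal.toReal_mul, ENNReal.toReal_mul, ENNReal.toReal_ofReal (pow_nonneg (by linarith) _),
    ENNReal.toReal_ofReal (by positivity), finrank_euclideanSpace_fin,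
    mul_div_mul_right _ _ hV, ← div_pow, add_div, div_self hr.ne']

theorem tendsto_volume_ball_pos {d : ℕ} :
    ∀ᶠ r : ℝ in atTop, 0 < (volume (Metric.ball (0 : Euc d) r)).toReal := by
  filter_upwards [eventually_gt_atTop 0] with r hr
  exact ENNReal.toReal_pos (Metric.measure_ball_pos _ _ hr).ne' measure_ball_lt_top.ne

theorem HasDensity.tendsto_ballCount_add {d : ℕ} {ι : Type} {x : ι → Euc d} {ρ : ℝ}
    (h : HasDensity x ρ) (c : ℝ) :
    Tendsto (fun r : ℝ => (ballCount x (r + c) : ℝ) /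
      (volume (Metric.ball (0 : Euc d) r)).toReal) atTop (𝓝 ρ) := by
  have h1 := (h.comp (tendsto_atTop_add_const_right _ c tendsto_id)).mul
    (tendsto_volume_ball_add_div (d := d) c)
  rw [mul_one] at h1
  refine h1.congr' ?_
  filter_upwards [(tendsto_atTop_add_const_right atTop c tendsto_id).eventually
    (tendsto_volume_ball_pos (d := d))] with r hr
  simp only [Function.comp, id] at hr ⊢
  rw [div_mul_div_cancel₀ hr.ne']
  rfl

theorem HasDensity.tendsto_ballCount_div {d : ℕ} {ι κ : Type} {x : ι → Euc d} {y : κ → Euc d}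
    {ρ ρ' : ℝ} (hx : HasDensity x ρ) (hy : HasDensity y ρ') (hρ : ρ ≠ 0) (c c' : ℝ) :
    Tendsto (fun r : ℝ => (ballCount y (r + c') : ℝ) / ballCount x (r + c)) atTop
      (𝓝 (ρ' / ρ)) := by
  refine ((hy.tendsto_ballCount_add c').div (hx.tendsto_ballCount_add c) hρ).congr' ?_
  filter_upwards [tendsto_volume_ball_pos (d := d)] with r hr
  exact div_div_div_cancel_right₀ hr.ne' _ _

theorem HasDensity.eventually_ballCount_pos {d : ℕ} {ι : Type} {x : ι → Euc d}
    {ρ : ℝ} (hx : HasDensity x ρ) (hρ : 0 < ρ) (c : ℝ) :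
    ∀ᶠ r : ℝ in atTop, 0 < ballCount x (r + c) := by
  filter_upwards [(hx.tendsto_ballCount_add c).eventually (lt_mem_nhds hρ)] with r hr
  by_contra h
  simp [show ballCount x (r + c) = 0 by omega] at hr

/-! ### Unions of translates of a lattice -/

/-- The configuration `⋃ i, y i + Φ`. -/
def periodicConfig {d : ℕ} {ι : Type} (y : ι → Euc d) (Φ : Submodule ℤ (Euc d)) :
    ι × Φ → Euc d := fun p => y p.1 + p.2

theorem finite_lattice_ball {d : ℕ} (Φ : Submodule ℤ (Euc d)) [DiscreteTopology Φ]
    [IsZLattice ℝ Φ] (c : Euc d) (r : ℝ) : {v : Φ | (v : Euc d) ∈ Metric.ball c r}.Finite := by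
  have h := ZSpan.setFinite_inter ((Module.Free.chooseBasis ℤ Φ).ofZLatticeBasis ℝ Φ)
    (Metric.isBounded_ball (x := c) (r := r))
  rw [Module.Basis.ofZLatticeBasis_span] at h
  refine Set.Finite.of_finite_image (f := Subtype.val) (h.subset ?_) Subtype.val_injective.injOn
  rintro _ ⟨v, hv, rfl⟩
  exact ⟨hv, v.2⟩

theorem infinite_lattice {d : ℕ} (hd : 0 < d) (Φ : Submodule ℤ (Euc d)) [DiscreteTopology Φ]
    [IsZLattice ℝ Φ] : Infinite Φ := by
  have : Nontrivial Φ := by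
    apply Module.nontrivial_of_finrank_pos (R := ℤ)
    rw [ZLattice.rank ℝ Φ, finrank_euclideanSpace_fin]
    exact hd
  obtain ⟨v, hv⟩ := exists_ne (0 : Φ)
  exact Infinite.of_injective (fun n : ℤ => n • v) (smul_left_injective ℤ hv)

theorem isInfiniteConfig_periodicConfig {d : ℕ} (hd : 0 < d) {ι : Type} [Finite ι] [Nonempty ι]
    (y : ι → Euc d) (Φ : Submodule ℤ (Euc d)) [DiscreteTopology Φ] [IsZLattice ℝ Φ] :
    IsInfiniteConfig (periodicConfig y Φ) := by
  have := infinite_lattice hd Φ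
  refine ⟨inferInstance, fun c r => ?_⟩
  have h : {p : ι × Φ | periodicConfig y Φ p ∈ Metric.ball c r} ⊆
      ⋃ i, (Prod.mk i) '' {v : Φ | (v : Euc d) ∈ Metric.ball (c - y i) r} := by
    rintro ⟨i, v⟩ h
    refine Set.mem_iUnion.2 ⟨i, v, ?_, rfl⟩
    simp only [Set.mem_ofPred_eq, periodicConfig, Metric.mem_ball, dist_eq_norm] at h ⊢
    convert h using 2
    abel
  exact (Set.finite_iUnion fun i => (finite_lattice_ball Φ _ _).image _).subset h

theorem isInfiniteConfig_latticeConfig {d : ℕ} (hd : 0 < d)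
    (Φ : Submodule ℤ (Euc d)) [DiscreteTopology Φ] [IsZLattice ℝ Φ] :
    IsInfiniteConfig (latticeConfig Φ) :=
  ⟨infinite_lattice hd Φ, finite_lattice_ball Φ⟩

theorem card_translate_ball_le {d : ℕ} (y : Euc d) {c : ℝ} (hy : ‖y‖ ≤ c)
    (Φ : Submodule ℤ (Euc d)) [DiscreteTopology Φ] [IsZLattice ℝ Φ] (r : ℝ) :
    Nat.card {v : Φ // y + (v : Euc d) ∈ Metric.ball (0 : Euc d) r} ≤
      ballCount (latticeConfig Φ) (r + c) := by
  have : Finite {v : Φ // latticeConfig Φ v ∈ Metric.ball (0 : Euc d) (r + c)} :=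
    (finite_lattice_ball Φ 0 (r + c)).to_subtype
  refine Nat.card_le_card_of_injective (Subtype.map id fun v hv => ?_)
    (Subtype.map_injective _ Function.injective_id)
  simp only [latticeConfig, Metric.mem_ball, dist_zero_right, id] at hv ⊢
  calc ‖(v : Euc d)‖ = ‖y + v - y‖ := by simp
    _ ≤ ‖y + v‖ + ‖y‖ := norm_sub_le _ _
    _ < r + c := by linarith

theorem le_card_translate_ball {d : ℕ} (y : Euc d) {c : ℝ} (hy : ‖y‖ ≤ c)
    (Φ : Submodule ℤ (Euc d)) [DiscreteTopology Φ] [IsZLattice ℝ Φ] (r : ℝ) :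
    ballCount (latticeConfig Φ) (r - c) ≤
      Nat.card {v : Φ // y + (v : Euc d) ∈ Metric.ball (0 : Euc d) r} := by
  have : Finite {v : Φ // y + (v : Euc d) ∈ Metric.ball (0 : Euc d) r} := by
    refine Set.Finite.to_subtype (s := {v : Φ | y + (v : Euc d) ∈ Metric.ball (0 : Euc d) r})
      ((finite_lattice_ball Φ (-y) r).subset fun v hv => ?_)
    simpa [dist_eq_norm, add_comm] using hv
  refine Nat.card_le_card_of_injective (Subtype.map id fun v hv => ?_)
    (Subtype.map_injective _ Function.injective_id)
  simp only [latticeConfig, Metric.mem_ball, dist_zero_right, id] at hv ⊢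
  calc ‖y + (v : Euc d)‖ ≤ ‖y‖ + ‖(v : Euc d)‖ := norm_add_le _ _
    _ < r := by linarith

theorem ballCount_periodicConfig {d : ℕ} {ι : Type} [Fintype ι]
    (y : ι → Euc d) (Φ : Submodule ℤ (Euc d)) [DiscreteTopology Φ] [IsZLattice ℝ Φ] (r : ℝ) :
    ballCount (periodicConfig y Φ) r =
      ∑ i, Nat.card {v : Φ // y i + (v : Euc d) ∈ Metric.ball (0 : Euc d) r} := by
  have : ∀ i, Finite {v : Φ // y i + (v : Euc d) ∈ Metric.ball (0 : Euc d) r} := by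
    intro i
    refine Set.Finite.to_subtype (s := {v : Φ | y i + (v : Euc d) ∈ Metric.ball (0 : Euc d) r})
      ((finite_lattice_ball Φ (-y i) r).subset fun v hv => ?_)
    simpa [dist_eq_norm, add_comm] using hv
  rw [← Nat.card_sigma]
  refine Nat.card_congr ⟨fun p => ⟨p.1.1, p.1.2, p.2⟩, fun p => ⟨(p.1, p.2.1), p.2.2⟩,
    fun _ => rfl, fun _ => rfl⟩

theorem ballCount_periodicConfig_le {d : ℕ} {ι : Type} [Fintype ι]
    (y : ι → Euc d) {c : ℝ} (hy : ∀ i, ‖y i‖ ≤ c) (Φ : Submodule ℤ (Euc d)) [DiscreteTopology Φ]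
    [IsZLattice ℝ Φ] (r : ℝ) :
    ballCount (periodicConfig y Φ) r ≤
      Fintype.card ι * ballCount (latticeConfig Φ) (r + c) := by
  rw [ballCount_periodicConfig]
  exact (Finset.sum_le_sum fun i _ => card_translate_ball_le (y i) (hy i) Φ r).trans (by simp)

theorem le_ballCount_periodicConfig {d : ℕ} {ι : Type} [Fintype ι]
    (y : ι → Euc d) {c : ℝ} (hy : ∀ i, ‖y i‖ ≤ c) (Φ : Submodule ℤ (Euc d)) [DiscreteTopology Φ]
    [IsZLattice ℝ Φ] (r : ℝ) :
    Fintype.card ι * ballCount (latticeConfig Φ) (r - c) ≤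
      ballCount (periodicConfig y Φ) r := by
  rw [ballCount_periodicConfig]
  refine le_trans (by simp) (Finset.sum_le_sum fun i _ => le_card_translate_ball (y i) (hy i) Φ r)

theorem exists_norm_le {d : ℕ} {ι : Type} [Finite ι] (y : ι → Euc d) : ∃ c, ∀ i, ‖y i‖ ≤ c := by
  obtain ⟨c, hc⟩ := (Set.finite_range fun i => ‖y i‖).bddAbove
  exact ⟨c, fun i => hc ⟨i, rfl⟩⟩

theorem HasDensity.periodicConfig {d : ℕ} {ι : Type} [Fintype ι]
    (y : ι → Euc d) {Φ : Submodule ℤ (Euc d)} [DiscreteTopology Φ]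
    [IsZLattice ℝ Φ] {ρ : ℝ} (h : HasDensity (latticeConfig Φ) ρ) :
    HasDensity (periodicConfig y Φ) (Fintype.card ι * ρ) := by
  obtain ⟨c, hc⟩ := exists_norm_le y
  refine tendsto_of_tendsto_of_tendsto_of_le_of_le
    ((h.tendsto_ballCount_add (-c)).const_mul (Fintype.card ι : ℝ))
    ((h.tendsto_ballCount_add c).const_mul (Fintype.card ι : ℝ)) (fun r => ?_) (fun r => ?_)
  · dsimp only
    rw [← mul_div_assoc]
    refine div_le_div_of_nonneg_right ?_ ENNReal.toReal_nonneg
    exact_mod_cast le_ballCount_periodicConfig y hc Φ r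
  · dsimp only
    rw [← mul_div_assoc]
    refine div_le_div_of_nonneg_right ?_ ENNReal.toReal_nonneg
    exact_mod_cast ballCount_periodicConfig_le y hc Φ r

theorem HasDensity.of_periodicConfig {d : ℕ} {ι : Type} [Fintype ι] [Nonempty ι]
    (y : ι → Euc d) {Φ : Submodule ℤ (Euc d)} [DiscreteTopology Φ]
    [IsZLattice ℝ Φ] {ρ : ℝ} (h : HasDensity (_root_.periodicConfig y Φ) ρ) :
    HasDensity (latticeConfig Φ) (ρ / Fintype.card ι) := by
  obtain ⟨c, hc⟩ := exists_norm_le y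
  have hι : (0 : ℝ) < Fintype.card ι := by exact_mod_cast Fintype.card_pos
  refine tendsto_of_tendsto_of_tendsto_of_le_of_le
    ((h.tendsto_ballCount_add (-c)).div_const (Fintype.card ι : ℝ))
    ((h.tendsto_ballCount_add c).div_const (Fintype.card ι : ℝ)) (fun r => ?_) (fun r => ?_)
  · dsimp only
    rw [div_right_comm]
    refine div_le_div_of_nonneg_right ?_ ENNReal.toReal_nonneg
    rw [div_le_iff₀' hι]
    have := ballCount_periodicConfig_le y hc Φ (r - c)
    rw [sub_add_cancel] at this
    exact_mod_cast this
  · dsimp only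
    rw [div_right_comm]
    refine div_le_div_of_nonneg_right ?_ ENNReal.toReal_nonneg
    rw [le_div_iff₀' hι]
    have := le_ballCount_periodicConfig y hc Φ (r + c)
    rw [add_sub_cancel_right] at this
    exact_mod_cast this

theorem HasDensity.comp_equiv {d : ℕ} {ι κ : Type} {x : ι → Euc d} {ρ : ℝ} (h : HasDensity x ρ)
    (e : κ ≃ ι) : HasDensity (x ∘ e) ρ := by
  refine h.congr fun r => ?_
  congr 2
  exact Nat.card_congr (e.subtypeEquiv fun _ => Iff.rfl).symm

/-! ### Fundamental domains -/

/-- If `Ω` is a fundamental domain of `Φ ⊆ Λ`, then `Λ` is the union of the translates of `Φ` by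
the points of `Λ ∩ Ω`. -/
noncomputable def IsFundDomain.equiv {d : ℕ} {Φ Λ : Submodule ℤ (Euc d)} {Ω : Set (Euc d)}
    (hΩ : IsFundDomain Φ Ω) (hΦ : Φ ≤ Λ) : ↥((Λ : Set (Euc d)) ∩ Ω) × Φ ≃ Λ :=
  Equiv.ofBijective (fun p => ⟨p.1 + p.2, Λ.add_mem p.1.2.1 (hΦ p.2.2)⟩) (by
    constructor
    · rintro ⟨⟨x, hx⟩, v⟩ ⟨⟨x', hx'⟩, v'⟩ h
      have h' : x + (v : Euc d) = x' + v' := congrArg Subtype.val h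
      have hv : v = v' := by
        have := (hΩ (x + v)).unique (y₁ := -v) (y₂ := -v') (by simpa using hx.2)
          (by rw [h']; simpa using hx'.2)
        exact neg_injective this
      subst hv
      simpa using h'
    · rintro ⟨x, hx⟩
      obtain ⟨v, hv, -⟩ := hΩ x
      exact ⟨(⟨x + v, Λ.add_mem hx (hΦ v.2), hv⟩, -v), by simp⟩)

theorem IsFundDomain.coe_equiv {d : ℕ} {Φ Λ : Submodule ℤ (Euc d)} {Ω : Set (Euc d)}
    (hΩ : IsFundDomain Φ Ω) (hΦ : Φ ≤ Λ) (p : ↥((Λ : Set (Euc d)) ∩ Ω) × Φ) :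
    (hΩ.equiv hΦ p : Euc d) = p.1 + p.2 := rfl

theorem isFundDomain_range_out {d : ℕ} (Φ : Submodule ℤ (Euc d)) :
    IsFundDomain Φ (Set.range (Quotient.out : Euc d ⧸ Φ → Euc d)) := by
  intro x
  have h : ∀ v : Φ, x + (v : Euc d) ∈ Set.range (Quotient.out : Euc d ⧸ Φ → Euc d) ↔
      (v : Euc d) = (Quotient.out (Submodule.Quotient.mk x : Euc d ⧸ Φ) : Euc d) - x := by
    intro v
    constructor
    · rintro ⟨q, hq⟩
      have : q = Submodule.Quotient.mk x := by
        rw [← Quotient.out_eq q, hq]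
        exact (Submodule.Quotient.eq Φ).2 (by simp)
      rw [← this, hq]
      simp
    · intro hv
      exact ⟨Submodule.Quotient.mk x, by rw [hv]; abel⟩
  have hm : (Quotient.out (Submodule.Quotient.mk x : Euc d ⧸ Φ) : Euc d) - x ∈ Φ :=
    (Submodule.Quotient.eq Φ).1 (Quotient.out_eq _)
  exact ⟨⟨_, hm⟩, (h _).2 rfl, fun v hv => Subtype.ext ((h v).1 hv)⟩

theorem IsFundDomain.card_eq {d : ℕ} {Φ Λ : Submodule ℤ (Euc d)} {Ω Ω' : Set (Euc d)}
    (hΩ : IsFundDomain Φ Ω) (hΩ' : IsFundDomain Φ Ω') (hΦ : Φ ≤ Λ) :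
    Nat.card ↥((Λ : Set (Euc d)) ∩ Ω) = Nat.card ↥((Λ : Set (Euc d)) ∩ Ω') := by
  refine Nat.card_eq_of_bijective
    (fun x : ↥((Λ : Set (Euc d)) ∩ Ω) => ((hΩ'.equiv hΦ).symm ⟨x, x.2.1⟩).1) ?_
  have key : ∀ (Ω Ω' : Set (Euc d)) (hΩ : IsFundDomain Φ Ω) (hΩ' : IsFundDomain Φ Ω'),
      Function.LeftInverse (fun x : ↥((Λ : Set (Euc d)) ∩ Ω') => ((hΩ.equiv hΦ).symm ⟨x, x.2.1⟩).1)
      (fun x : ↥((Λ : Set (Euc d)) ∩ Ω) => ((hΩ'.equiv hΦ).symm ⟨x, x.2.1⟩).1) := by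
    intro Ω Ω' hΩ hΩ' x
    set p := (hΩ'.equiv hΦ).symm ⟨x, x.2.1⟩ with hp
    have h1 : hΩ'.equiv hΦ p = ⟨x, x.2.1⟩ := by simp [hp]
    have h2 : (p.1 : Euc d) + p.2 = x := congrArg Subtype.val h1
    have h3 : (hΩ.equiv hΦ).symm ⟨p.1, p.1.2.1⟩ = (x, -p.2) := by
      rw [Equiv.symm_apply_eq]
      ext1
      simp [IsFundDomain.coe_equiv, ← h2]
    exact congrArg Prod.fst h3
  exact ⟨(key Ω Ω' hΩ hΩ').injective, (key Ω' Ω hΩ' hΩ).surjective⟩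

/-! ### The energy of a lattice and of its periodic competitors -/

open Classical in
/-- The sum `∑ f (|v| ^ 2)` over the nonzero vectors of `Φ`, which is the average `f`-energy of a
lattice `Φ`. -/
noncomputable def latticeSum {d : ℕ} (f : ℝ≥0 → ℝ≥0∞) (Φ : Submodule ℤ (Euc d)) : ℝ≥0∞ :=
  ∑' v : Φ, if v = 0 then 0 else radialPotential f (v : Euc d)

theorem energyPerPoint_latticeConfig_le {d : ℕ} (f : ℝ≥0 → ℝ≥0∞) (Λ : Submodule ℤ (Euc d))
    [DiscreteTopology Λ] [IsZLattice ℝ Λ] (r : ℝ) :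
    energyPerPoint f (latticeConfig Λ) r ≤ latticeSum f Λ := by
  classical
  have : Finite {i : Λ // latticeConfig Λ i ∈ Metric.ball (0 : Euc d) r} :=
    (finite_lattice_ball Λ 0 r).to_subtype
  have := Fintype.ofFinite {i : Λ // latticeConfig Λ i ∈ Metric.ball (0 : Euc d) r}
  refine ENNReal.div_le_of_le_mul' ?_
  rw [configEnergy_eq]
  calc _ ≤ ∑' _i : {i : Λ // latticeConfig Λ i ∈ Metric.ball (0 : Euc d) r}, latticeSum f Λ := by
        refine ENNReal.tsum_le_tsum fun i => ?_
        refine le_trans (le_of_eq ?_) (ENNReal.tsum_comp_le_tsum_of_injective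
          (f := fun j : {i : Λ // latticeConfig Λ i ∈ Metric.ball (0 : Euc d) r} => i.1 - j.1)
          ((sub_right_injective (b := i.1)).comp Subtype.val_injective) _)
        refine tsum_congr fun j => ?_
        by_cases h : j = i
        · simp [h]
        · have h2 : i.1 - j.1 ≠ 0 := fun h3 => h (Subtype.ext (sub_eq_zero.1 h3).symm)
          rw [if_neg h, if_neg h2]
          rfl
    _ = _ := by rw [tsum_fintype, Nat.card_eq_fintype_card]; simp

/-- A point at distance more than `c` from the boundary of the ball interacts with all its neighbours
at distance at most `c`. -/
theorem le_configEnergy_restrictBall_latticeConfig {d : ℕ} (f : ℝ≥0 → ℝ≥0∞)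
    (Λ : Submodule ℤ (Euc d)) [DiscreteTopology Λ] [IsZLattice ℝ Λ] (T : Finset Λ) {c : ℝ}
    (hc0 : 0 ≤ c) (hc : ∀ v ∈ T, ‖(v : Euc d)‖ ≤ c) (r : ℝ) :
    (ballCount (latticeConfig Λ) (r - c) : ℝ≥0∞) *
        (∑ v ∈ T, open Classical in if v = 0 then 0 else radialPotential f (v : Euc d)) ≤
      configEnergy (radialPotential f) (restrictBall (latticeConfig Λ) r) := by
  classical
  have : Finite {i : Λ // latticeConfig Λ i ∈ Metric.ball (0 : Euc d) (r - c)} :=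
    (finite_lattice_ball Λ 0 (r - c)).to_subtype
  have := Fintype.ofFinite {i : Λ // latticeConfig Λ i ∈ Metric.ball (0 : Euc d) (r - c)}
  rw [configEnergy_eq]
  have hsub : ∀ i : Λ, latticeConfig Λ i ∈ Metric.ball (0 : Euc d) (r - c) →
      latticeConfig Λ i ∈ Metric.ball (0 : Euc d) r :=
    fun i hi => Metric.ball_subset_ball (by linarith) hi
  refine le_trans ?_ (ENNReal.tsum_comp_le_tsum_of_injective
    (f := fun i : {i : Λ // latticeConfig Λ i ∈ Metric.ball (0 : Euc d) (r - c)} =>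
      (⟨i.1, hsub i.1 i.2⟩ : {i : Λ // latticeConfig Λ i ∈ Metric.ball (0 : Euc d) r}))
    (fun _ _ h => Subtype.ext (congrArg (fun i => i.1) h)) _)
  calc _ = ∑' _i : {i : Λ // latticeConfig Λ i ∈ Metric.ball (0 : Euc d) (r - c)},
        (∑ v ∈ T, if v = 0 then 0 else radialPotential f (v : Euc d)) := by
        rw [tsum_fintype, ballCount, Nat.card_eq_fintype_card, ← nsmul_eq_mul]
        exact (Finset.sum_const _).symm
    _ ≤ _ := by
        refine ENNReal.tsum_le_tsum fun i => ?_
        have hmem : ∀ v : T, latticeConfig Λ (i.1 - v.1) ∈ Metric.ball (0 : Euc d) r := by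
          intro v
          have h1 := i.2
          have h2 := hc v.1 v.2
          simp only [latticeConfig, Metric.mem_ball, dist_zero_right, Submodule.coe_sub] at h1 ⊢
          exact (norm_sub_le _ _).trans_lt (by linarith)
        have hinj : Function.Injective (fun v : T =>
            (⟨i.1 - v.1, hmem v⟩ : {i : Λ // latticeConfig Λ i ∈ Metric.ball (0 : Euc d) r})) := by
          intro v w h
          exact Subtype.ext (sub_right_injective (congrArg Subtype.val h))
        refine le_trans (le_of_eq ?_) (ENNReal.tsum_comp_le_tsum_of_injective hinj _)
        rw [← Finset.tsum_subtype]
        refine tsum_congr fun v => ?_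
        have : (⟨i.1 - v.1, hmem v⟩ : {i : Λ // latticeConfig Λ i ∈ Metric.ball (0 : Euc d) r}) =
            ⟨i.1, hsub i.1 i.2⟩ ↔ v.1 = 0 := by
          rw [Subtype.ext_iff]
          simp
        simp only [this]
        simp [restrictBall, latticeConfig]

theorem tendsto_energyPerPoint_latticeConfig {d : ℕ} (f : ℝ≥0 → ℝ≥0∞) (Λ : Submodule ℤ (Euc d))
    [DiscreteTopology Λ] [IsZLattice ℝ Λ] {ρ : ℝ} (hρ : 0 < ρ)
    (hΛ : HasDensity (latticeConfig Λ) ρ) :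
    Tendsto (fun r => energyPerPoint f (latticeConfig Λ) r) atTop (𝓝 (latticeSum f Λ)) := by
  classical
  refine tendsto_order.2 ⟨fun a ha => ?_, fun a ha => Eventually.of_forall fun r =>
    (energyPerPoint_latticeConfig_le f Λ r).trans_lt ha⟩
  rw [latticeSum, ENNReal.tsum_eq_iSup_sum] at ha
  obtain ⟨T, hT⟩ := lt_iSup_iff.1 ha
  obtain ⟨c, hc⟩ := exists_norm_le (fun v : T => (v.1 : Euc d))
  set S := ∑ v ∈ T, if v = 0 then 0 else radialPotential f (v : Euc d)
  have hlim : Tendsto (fun r => ENNReal.ofReal ((ballCount (latticeConfig Λ) (r + -max c 0) : ℝ) /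
      ballCount (latticeConfig Λ) (r + 0)) * S) atTop (𝓝 S) := by
    have h1 := ENNReal.tendsto_ofReal (hΛ.tendsto_ballCount_div hΛ hρ.ne' 0 (-max c 0))
    rw [div_self hρ.ne', ENNReal.ofReal_one] at h1
    simpa using ENNReal.Tendsto.mul_const h1 (Or.inl one_ne_zero)
  filter_upwards [hlim.eventually (lt_mem_nhds hT), hΛ.eventually_ballCount_pos hρ 0] with r hr hp
  refine hr.trans_le ?_
  rw [add_zero] at hp ⊢
  rw [ENNReal.ofReal_div_of_pos (by exact_mod_cast hp), ENNReal.ofReal_natCast,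
    ENNReal.ofReal_natCast, mul_comm, ← mul_div_assoc, mul_comm]
  exact ENNReal.div_le_div_right (le_configEnergy_restrictBall_latticeConfig f Λ T
    (le_max_right _ _) (fun v hv => (hc ⟨v, hv⟩).trans (le_max_left _ _)) r) _

theorem tsum_periodicConfig {d : ℕ} (f : ℝ≥0 → ℝ≥0∞) (Φ : Submodule ℤ (Euc d)) {ι : Type}
    (y : ι → Euc d) (p : ι × Φ) [DecidableEq ι] [DecidableEq (ι × Φ)] :
    (∑' q, if q = p then 0 else radialPotential f (periodicConfig y Φ p - periodicConfig y Φ q)) =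
      (∑' j, if j = p.1 then 0 else periodizedPotential f Φ (y p.1 - y j)) + latticeSum f Φ := by
  classical
  obtain ⟨i, v⟩ := p
  rw [ENNReal.tsum_prod', ENNReal.tsum_eq_add_tsum_ite i, add_comm]
  congr 1
  · refine tsum_congr fun j => ?_
    by_cases h : j = i
    · simp [h]
    · simp only [h, if_false, periodizedPotential, Prod.mk.injEq, false_and]
      rw [← (Equiv.subLeft v).tsum_eq]
      refine tsum_congr fun w => ?_
      simp only [periodicConfig, radialPotential, Equiv.subLeft_apply, Submodule.coe_sub]
      congr 4
      abel
  · rw [latticeSum, ← (Equiv.subLeft v).tsum_eq]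
    refine tsum_congr fun w => ?_
    simp [periodicConfig]

/-- The average energy of `⋃ i, y i + Φ` in terms of the energy of `y` for the periodized
potential. -/
theorem lowerEnergy_periodicConfig_le {d : ℕ} (f : ℝ≥0 → ℝ≥0∞) (Φ : Submodule ℤ (Euc d))
    [DiscreteTopology Φ] [IsZLattice ℝ Φ] {ρ : ℝ} (hρ : 0 < ρ)
    (hΦ : HasDensity (latticeConfig Φ) ρ) {ι : Type} [Fintype ι] [Nonempty ι] (y : ι → Euc d) :
    lowerEnergy f (periodicConfig y Φ) ≤
      (configEnergy (periodizedPotential f Φ) y + Fintype.card ι * latticeSum f Φ) /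
        Fintype.card ι := by
  classical
  obtain ⟨c, hc⟩ := exists_norm_le y
  have hι : (0 : ℝ) < Fintype.card ι := by exact_mod_cast Fintype.card_pos
  set A := configEnergy (periodizedPotential f Φ) y + Fintype.card ι * latticeSum f Φ with hA
  have hfin : ∀ r (i : ι), Finite {v : Φ // y i + (v : Euc d) ∈ Metric.ball (0 : Euc d) r} := by
    intro r i
    refine Set.Finite.to_subtype (s := {v : Φ | y i + (v : Euc d) ∈ Metric.ball (0 : Euc d) r})
      ((finite_lattice_ball Φ (-y i) r).subset fun v hv => ?_)
    simpa [dist_eq_norm, add_comm] using hv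
  have hE : ∀ r, configEnergy (radialPotential f) (restrictBall (periodicConfig y Φ) r) ≤
      (ballCount (latticeConfig Φ) (r + c) : ℝ≥0∞) * A := by
    intro r
    have := fun i => Fintype.ofFinite
      {v : Φ // y i + (v : Euc d) ∈ Metric.ball (0 : Euc d) r}
    let e : (Σ i, {v : Φ // y i + (v : Euc d) ∈ Metric.ball (0 : Euc d) r}) ≃
        {p : ι × Φ // periodicConfig y Φ p ∈ Metric.ball (0 : Euc d) r} :=
      ⟨fun p => ⟨(p.1, p.2.1), p.2.2⟩, fun p => ⟨p.1.1, p.1.2, p.2⟩, fun _ => rfl, fun _ => rfl⟩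
    rw [configEnergy_eq]
    calc _ ≤ ∑' p : {p : ι × Φ // periodicConfig y Φ p ∈ Metric.ball (0 : Euc d) r},
          ((∑' j, if j = p.1.1 then 0 else periodizedPotential f Φ (y p.1.1 - y j)) +
            latticeSum f Φ) := by
          refine ENNReal.tsum_le_tsum fun p => ?_
          rw [← tsum_periodicConfig]
          refine le_trans (le_of_eq ?_)
            (ENNReal.tsum_comp_le_tsum_of_injective (f := fun q :
              {p : ι × Φ // periodicConfig y Φ p ∈ Metric.ball (0 : Euc d) r} => q.1)
              Subtype.val_injective _)
          refine tsum_congr fun q => ?_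
          simp [Subtype.ext_iff, restrictBall]
      _ = ∑ i, (Nat.card {v : Φ // y i + (v : Euc d) ∈ Metric.ball (0 : Euc d) r} : ℝ≥0∞) *
          ((∑' j, if j = i then 0 else periodizedPotential f Φ (y i - y j)) +
            latticeSum f Φ) := by
          rw [← e.tsum_eq, ENNReal.tsum_sigma', tsum_fintype]
          refine Finset.sum_congr rfl fun i _ => ?_
          rw [tsum_fintype, Nat.card_eq_fintype_card, ← nsmul_eq_mul]
          simp only [e, Equiv.coe_fn_mk]
          rw [Finset.sum_const, Finset.card_univ]
      _ ≤ ∑ i, (ballCount (latticeConfig Φ) (r + c) : ℝ≥0∞) *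
          ((∑' j, if j = i then 0 else periodizedPotential f Φ (y i - y j)) +
            latticeSum f Φ) := by
          refine Finset.sum_le_sum fun i _ => mul_le_mul_left ?_ _
          exact_mod_cast card_translate_ball_le (y i) (hc i) Φ r
      _ = _ := by
          rw [← Finset.mul_sum, hA, configEnergy_eq, tsum_fintype, Finset.sum_add_distrib]
          simp
  have hρ' : (Fintype.card ι * ρ) ≠ 0 := by positivity
  have hlim : Tendsto (fun r => ENNReal.ofReal ((ballCount (latticeConfig Φ) (r + c) : ℝ) /
      ballCount (periodicConfig y Φ) (r + 0)) * A) atTop (𝓝 (A / Fintype.card ι)) := by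
    have h1 := ENNReal.tendsto_ofReal ((hΦ.periodicConfig y).tendsto_ballCount_div hΦ hρ' 0 c)
    have h2 : ρ / (Fintype.card ι * ρ) = (Fintype.card ι : ℝ)⁻¹ := by field_simp
    rw [h2, ENNReal.ofReal_inv_of_pos hι, ENNReal.ofReal_natCast] at h1
    rw [ENNReal.div_eq_inv_mul]
    exact ENNReal.Tendsto.mul_const h1 (Or.inl (by simp))
  rw [lowerEnergy, ← hlim.liminf_eq]
  refine liminf_le_liminf ?_
  filter_upwards [(hΦ.periodicConfig y).eventually_ballCount_pos (by positivity) 0] with r hp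
  rw [add_zero] at hp ⊢
  rw [ENNReal.ofReal_div_of_pos (by exact_mod_cast hp), ENNReal.ofReal_natCast,
    ENNReal.ofReal_natCast, mul_comm, ← mul_div_assoc, mul_comm]
  exact ENNReal.div_le_div_right (hE r) _

theorem IsFundDomain.eq_of_sub_mem {d : ℕ} {Φ : Submodule ℤ (Euc d)} {Ω : Set (Euc d)}
    (hΩ : IsFundDomain Φ Ω) {x y : Euc d} (hx : x ∈ Ω) (hy : y ∈ Ω) (h : x - y ∈ Φ) : x = y := by
  have := (hΩ y).unique (y₁ := ⟨x - y, h⟩) (y₂ := 0) (by simpa using hx) (by simpa using hy)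
  simpa [sub_eq_zero] using congrArg Subtype.val this

open Classical in
/-- The energy of `Λ ∩ Ω`, for every fundamental domain `Ω` of `Φ`. -/
theorem configEnergy_inter_fundDomain {d : ℕ} (f : ℝ≥0 → ℝ≥0∞) {Φ Λ : Submodule ℤ (Euc d)}
    {Ω : Set (Euc d)} (hΩ : IsFundDomain Φ Ω) (hΦ : Φ ≤ Λ) [Finite ↥((Λ : Set (Euc d)) ∩ Ω)] :
    configEnergy (periodizedPotential f Φ) (fun x : ↥((Λ : Set (Euc d)) ∩ Ω) => (x : Euc d)) =
      (Nat.card ↥((Λ : Set (Euc d)) ∩ Ω) : ℝ≥0∞) *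
        ∑' u : Λ, if (u : Euc d) ∈ Φ then 0 else radialPotential f (u : Euc d) := by
  have := Fintype.ofFinite ↥((Λ : Set (Euc d)) ∩ Ω)
  have key : ∀ x : ↥((Λ : Set (Euc d)) ∩ Ω),
      (∑' y : ↥((Λ : Set (Euc d)) ∩ Ω), if y = x then 0 else
        periodizedPotential f Φ ((x : Euc d) - y)) =
      ∑' u : Λ, if (u : Euc d) ∈ Φ then 0 else radialPotential f (u : Euc d) := by
    intro x
    rw [← (((Equiv.prodCongr (Equiv.refl _) (Equiv.neg Φ)).trans (hΩ.equiv hΦ)).trans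
      (Equiv.subLeft (⟨x, x.2.1⟩ : Λ))).tsum_eq, ENNReal.tsum_prod']
    refine tsum_congr fun y => ?_
    have hval : ∀ v : Φ, ((((Equiv.prodCongr (Equiv.refl _) (Equiv.neg Φ)).trans
        (hΩ.equiv hΦ)).trans (Equiv.subLeft (⟨x, x.2.1⟩ : Λ)) (y, v) : Λ) : Euc d) =
        (x : Euc d) - y + v := by
      intro v
      simp [IsFundDomain.coe_equiv]
      abel
    simp_rw [hval]
    have hmem : ∀ v : Φ, (x : Euc d) - y + v ∈ Φ ↔ y = x := by
      intro v
      rw [Submodule.add_mem_iff_left _ v.2]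
      constructor
      · intro h
        exact (Subtype.ext (hΩ.eq_of_sub_mem x.2.2 y.2.2 h)).symm
      · rintro rfl
        simp
    simp_rw [hmem]
    split_ifs
    · exact tsum_zero.symm
    · rfl
  rw [configEnergy_eq]
  simp_rw [key]
  simp [tsum_fintype, Nat.card_eq_fintype_card]

open Classical in
theorem latticeSum_eq_add {d : ℕ} (f : ℝ≥0 → ℝ≥0∞) {Φ Λ : Submodule ℤ (Euc d)} (hΦ : Φ ≤ Λ) :
    latticeSum f Λ = latticeSum f Φ +
      ∑' u : Λ, if (u : Euc d) ∈ Φ then 0 else radialPotential f (u : Euc d) := by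
  have h1 : latticeSum f Φ = ∑' u : Λ, if (u : Euc d) ∈ Φ ∧ u ≠ 0 then
      radialPotential f (u : Euc d) else 0 := by
    rw [latticeSum, ← (Submodule.inclusion_injective hΦ).tsum_eq]
    · refine tsum_congr fun v => ?_
      by_cases hv : v = 0
      · simp [hv]
      · have : Submodule.inclusion hΦ v ≠ 0 := fun h => hv (Submodule.inclusion_injective hΦ h)
        simp [hv, this]
    · intro u hu
      by_cases h : (u : Euc d) ∈ Φ
      · exact ⟨⟨u, h⟩, rfl⟩
      · simp [h] at hu
  rw [h1, latticeSum, ← ENNReal.tsum_add]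
  refine tsum_congr fun u => ?_
  by_cases hu : u = 0
  · simp [hu]
  · by_cases h : (u : Euc d) ∈ Φ <;> simp [hu, h]

theorem finite_inter_fundDomain {d : ℕ} {Φ Λ : Submodule ℤ (Euc d)} [DiscreteTopology Λ]
    [IsZLattice ℝ Λ] (hΦ : IsSubZLattice Φ Λ) {Ω : Set (Euc d)} (hΩ : IsFundDomain Φ Ω) :
    Finite ↥((Λ : Set (Euc d)) ∩ Ω) := by
  obtain ⟨hle, _, _⟩ := hΦ
  set b := (Module.Free.chooseBasis ℤ Φ).ofZLatticeBasis ℝ Φ with hb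
  have hspan : Submodule.span ℤ (Set.range b) = Φ := Module.Basis.ofZLatticeBasis_span ..
  have hΩ' : IsFundDomain Φ (ZSpan.fundamentalDomain b) := by
    intro x
    have := ZSpan.exist_unique_vadd_mem_fundamentalDomain b x
    rw [hspan] at this
    simpa [Submodule.vadd_def, add_comm] using this
  have h1 : Finite ↥((Λ : Set (Euc d)) ∩ ZSpan.fundamentalDomain b) := by
    obtain ⟨r, hr⟩ := (ZSpan.fundamentalDomain_isBounded b).subset_ball 0
    refine Set.Finite.to_subtype
      (((finite_lattice_ball Λ 0 r).image Subtype.val).subset ?_)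
    rintro x ⟨hx, hx'⟩
    exact ⟨⟨x, hx⟩, hr hx', rfl⟩
  have h2 : Nonempty ↥((Λ : Set (Euc d)) ∩ ZSpan.fundamentalDomain b) :=
    ⟨⟨0, Λ.zero_mem, by simp [ZSpan.mem_fundamentalDomain]⟩⟩
  apply Nat.finite_of_card_ne_zero
  rw [hΩ.card_eq hΩ' hle]
  exact Nat.card_pos.ne'

theorem nonempty_inter_fundDomain {d : ℕ} {Φ Λ : Submodule ℤ (Euc d)} (hΦ : Φ ≤ Λ)
    {Ω : Set (Euc d)} (hΩ : IsFundDomain Φ Ω) : Nonempty ↥((Λ : Set (Euc d)) ∩ Ω) :=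
  ⟨((hΩ.equiv hΦ).symm 0).1⟩

theorem hasDensity_sublattice {d : ℕ} {Φ Λ : Submodule ℤ (Euc d)} [DiscreteTopology Λ]
    [IsZLattice ℝ Λ] {ρ : ℝ} (hΛ : HasDensity (latticeConfig Λ) ρ) (hΦ : IsSubZLattice Φ Λ)
    {Ω : Set (Euc d)} (hΩ : IsFundDomain Φ Ω) :
    HasDensity (latticeConfig Φ) (ρ / Nat.card ↥((Λ : Set (Euc d)) ∩ Ω)) := by
  have := finite_inter_fundDomain hΦ hΩ
  have := Fintype.ofFinite ↥((Λ : Set (Euc d)) ∩ Ω)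
  obtain ⟨hle, _, _⟩ := hΦ
  have := nonempty_inter_fundDomain hle hΩ
  rw [Nat.card_eq_fintype_card]
  exact HasDensity.of_periodicConfig _ (hΛ.comp_equiv (hΩ.equiv hle))

/-- A competitor with less energy in the torus `ℝ ^ d / Φ` lifts to a periodic configuration with
less energy than `Λ`. -/
theorem IsOptimalOfDensity.isPeriodicOptimal {d : ℕ} (hd : 0 < d) {f : ℝ≥0 → ℝ≥0∞}
    {Φ Λ : Submodule ℤ (Euc d)} [DiscreteTopology Λ] [IsZLattice ℝ Λ] {ρ : ℝ} (hρ : 0 < ρ)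
    (hΛ : HasDensity (latticeConfig Λ) ρ) (hopt : IsOptimalOfDensity f ρ (latticeConfig Λ))
    (hfin : latticeSum f Λ ≠ ∞) (hΦ : IsSubZLattice Φ Λ) : IsPeriodicOptimal f Λ Φ := by
  intro Ω hΩ
  have hf := finite_inter_fundDomain hΦ hΩ
  have hdens := hasDensity_sublattice hΛ hΦ hΩ
  obtain ⟨hle, _, _⟩ := hΦ
  have := nonempty_inter_fundDomain hle hΩ
  set N := Nat.card ↥((Λ : Set (Euc d)) ∩ Ω) with hN
  have hN0 : 0 < N := Nat.card_pos
  refine ⟨hf, le_antisymm (le_iInf fun y => ?_) ?_⟩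
  · obtain ⟨-, -, e, he, hmin⟩ := hopt
    obtain rfl := tendsto_nhds_unique he (tendsto_energyPerPoint_latticeConfig f Λ hρ hΛ)
    have : Nonempty (Fin N) := ⟨⟨0, hN0⟩⟩
    have hNR : (0 : ℝ) < N := by exact_mod_cast hN0
    have h1 := hmin _ (periodicConfig y Φ) (isInfiniteConfig_periodicConfig hd y Φ) (by
      have := hdens.periodicConfig y
      rwa [Fintype.card_fin, mul_div_cancel₀ _ hNR.ne'] at this)
    have h2 := h1.trans (lowerEnergy_periodicConfig_le f Φ (by positivity) hdens y)
    have hS : latticeSum f Φ ≠ ∞ := by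
      rw [latticeSum_eq_add f hle] at hfin
      exact (ENNReal.add_ne_top.1 hfin).1
    rw [Fintype.card_fin, ENNReal.le_div_iff_mul_le (Or.inl (by positivity)) (Or.inl (by simp)),
      latticeSum_eq_add f hle, add_mul, mul_comm, add_comm,
      ENNReal.add_le_add_iff_right (ENNReal.mul_ne_top (by simp) hS)] at h2
    rw [configEnergy_inter_fundDomain f hΩ hle, mul_comm]
    exact h2
  · have := Fintype.ofFinite ↥((Λ : Set (Euc d)) ∩ Ω)
    exact minEnergy_le_configEnergy _ _ Nat.card_eq_fintype_card.le

/-! ### Boxes -/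

/-- The vector of the lattice spanned by `b` with integral coordinates `n`. -/
noncomputable def intVec {d : ℕ} (b : Module.Basis (Fin d) ℝ (Euc d)) (n : Fin d → ℤ) : Euc d :=
  b.equivFun.symm fun i => (n i : ℝ)

@[simp]
theorem repr_intVec {d : ℕ} (b : Module.Basis (Fin d) ℝ (Euc d)) (n : Fin d → ℤ) (i : Fin d) :
    b.repr (intVec b n) i = n i := by
  rw [← b.equivFun_apply, intVec, LinearEquiv.apply_symm_apply]

theorem mem_span_iff_intVec {d : ℕ} (b : Module.Basis (Fin d) ℝ (Euc d)) (x : Euc d) :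
    x ∈ Submodule.span ℤ (Set.range b) ↔ ∃ n, x = intVec b n := by
  rw [b.mem_span_iff_repr_mem ℤ]
  constructor
  · intro h
    choose n hn using h
    refine ⟨n, b.ext_elem fun i => ?_⟩
    rw [repr_intVec, ← hn i]
    simp
  · rintro ⟨n, rfl⟩ i
    exact ⟨n i, by simp⟩

theorem exists_basis_span {d : ℕ} (Φ : Submodule ℤ (Euc d)) [DiscreteTopology Φ]
    [IsZLattice ℝ Φ] :
    ∃ b : Module.Basis (Fin d) ℝ (Euc d), Submodule.span ℤ (Set.range b) = Φ := by
  have h : Module.finrank ℤ Φ = d := by rw [ZLattice.rank ℝ Φ, finrank_euclideanSpace_fin]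
  let b := (Module.finBasisOfFinrankEq ℤ Φ h).ofZLatticeBasis ℝ Φ
  exact ⟨b, Module.Basis.ofZLatticeBasis_span ..⟩

/-- The box `ℓ • P`, shrunk by the factor `1 - 1 / q`, where `P` is the parallelepiped spanned by
`b`. Distinct translates of it by vectors of the lattice `ℓ • Φ` are at distance of order `ℓ`. -/
def subcell {d : ℕ} (b : Module.Basis (Fin d) ℝ (Euc d)) (q ℓ : ℕ) : Set (Euc d) :=
  {x | ∀ i, 0 ≤ b.repr x i ∧ b.repr x i < ℓ * (1 - 1 / q : ℝ)}

theorem exists_norm_comparison {d : ℕ} (b : Module.Basis (Fin d) ℝ (Euc d)) :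
    ∃ A : ℝ, 0 < A ∧ (∀ x, ‖b.equivFun x‖ ≤ A * ‖x‖) ∧ ∀ x, ‖x‖ ≤ A * ‖b.equivFun x‖ := by
  refine ⟨max 1 (max ‖(b.equivFunL : Euc d →L[ℝ] (Fin d → ℝ))‖
    ‖(b.equivFunL.symm : (Fin d → ℝ) →L[ℝ] Euc d)‖), by positivity, fun x => ?_, fun x => ?_⟩
  · refine ((b.equivFunL : Euc d →L[ℝ] (Fin d → ℝ)).le_opNorm x).trans ?_
    gcongr
    exact (le_max_left _ _).trans (le_max_right _ _)
  · have := (b.equivFunL.symm : (Fin d → ℝ) →L[ℝ] Euc d).le_opNorm (b.equivFun x)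
    have h2 : (b.equivFunL.symm : (Fin d → ℝ) →L[ℝ] Euc d) (b.equivFun x) = x :=
      b.equivFun.symm_apply_apply x
    rw [h2] at this
    refine this.trans ?_
    gcongr
    exact (le_max_right _ _).trans (le_max_right _ _)

/-- Points of distinct translates of the shrunk box are as far apart as the translation vectors, up
to a constant: if the `i`-th coordinate of the translation is a nonzero integer `n i`, then in this
coordinate the points differ by at least `ℓ * (|n i| - (1 - 1 / q)) ≥ ℓ * |n i| / q`. -/
theorem exists_gap {d : ℕ} (b : Module.Basis (Fin d) ℝ (Euc d)) {q : ℕ} (hq : 0 < q) :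
    ∃ c : ℝ, 0 < c ∧ ∀ ℓ : ℕ, 0 < ℓ → ∀ x ∈ subcell b q ℓ, ∀ y ∈ subcell b q ℓ, ∀ n : Fin d → ℤ,
      c * ℓ * ‖intVec b n‖ ≤ ‖x - y + (ℓ : ℝ) • intVec b n‖ := by
  obtain ⟨A, hA, h1, h2⟩ := exists_norm_comparison b
  have hqR : (0 : ℝ) < q := by exact_mod_cast hq
  refine ⟨1 / (q * A * A), by positivity, fun ℓ hℓ x hx y hy n => ?_⟩
  have hℓR : (0 : ℝ) < ℓ := by exact_mod_cast hℓ
  set z := x - y + (ℓ : ℝ) • intVec b n with hz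
  have key : ‖b.equivFun (intVec b n)‖ ≤ q / ℓ * ‖b.equivFun z‖ := by
    rw [pi_norm_le_iff_of_nonneg (by positivity)]
    intro i
    refine le_trans ?_ (mul_le_mul_of_nonneg_left (norm_le_pi_norm _ i) (by positivity))
    rw [b.equivFun_apply, b.equivFun_apply, repr_intVec, div_mul_eq_mul_div, le_div_iff₀ hℓR]
    have hzi : b.repr z i = b.repr x i - b.repr y i + ℓ * n i := by simp [hz]
    rw [hzi, Real.norm_eq_abs, Real.norm_eq_abs]
    rcases eq_or_ne (n i) 0 with h0 | h0
    · rw [h0]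
      simp only [Int.cast_zero, abs_zero, zero_mul]
      positivity
    have hn : (1 : ℝ) ≤ |(n i : ℝ)| := by exact_mod_cast Int.one_le_abs h0
    have hxy : |b.repr x i - b.repr y i| ≤ ℓ * (1 - 1 / q : ℝ) :=
      abs_le.2 ⟨by linarith [(hx i).1, (hy i).2], by linarith [(hx i).2, (hy i).1]⟩
    have h3 : |(ℓ * n i : ℝ)| - |b.repr x i - b.repr y i| ≤
        |b.repr x i - b.repr y i + ℓ * n i| := by
      have := abs_sub_abs_le_abs_sub (ℓ * n i : ℝ) (-(b.repr x i - b.repr y i))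
      rw [abs_neg, sub_neg_eq_add, add_comm (ℓ * n i : ℝ)] at this
      exact this
    rw [abs_mul, abs_of_pos hℓR] at h3
    have hq1 : (1 : ℝ) ≤ q := by exact_mod_cast hq
    have h4 : (q : ℝ) * (ℓ * |(n i : ℝ)| - ℓ * (1 - 1 / q)) ≤
        q * |b.repr x i - b.repr y i + ℓ * n i| := by
      refine mul_le_mul_of_nonneg_left ?_ hqR.le
      linarith
    have h5 : (q : ℝ) * (ℓ * |(n i : ℝ)| - ℓ * (1 - 1 / q)) =
        q * ℓ * (|(n i : ℝ)| - 1) + ℓ := by field_simp; ring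
    nlinarith [mul_nonneg hℓR.le (sub_nonneg.2 hn)]
  calc 1 / (q * A * A) * ℓ * ‖intVec b n‖
      ≤ 1 / (q * A * A) * ℓ * (A * (q / ℓ * (A * ‖z‖))) := by
        gcongr
        refine (h2 _).trans ?_
        gcongr
        refine key.trans ?_
        gcongr
        exact h1 z
    _ = ‖z‖ := by field_simp

/-- By rapid decay, the interaction of points of distinct shrunk boxes of size `ℓ` is bounded by
`ℓ ^ (-s)` times a summable function of the relative position of the boxes. -/
theorem exists_interaction_bound {d : ℕ} {f : ℝ≥0 → ℝ≥0∞} (hf : HasRapidDecay d f)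
    {Φ : Submodule ℤ (Euc d)} [DiscreteTopology Φ] [IsZLattice ℝ Φ]
    (b : Module.Basis (Fin d) ℝ (Euc d)) (hb : Submodule.span ℤ (Set.range b) = Φ)
    {q : ℕ} (hq : 0 < q) :
    ∃ s : ℝ, (d : ℝ) < s ∧ ∃ g : (Fin d → ℤ) → ℝ≥0∞, (∑' n, g n) ≠ ∞ ∧ ∃ ℓ₀ : ℕ, 0 < ℓ₀ ∧
      ∀ ℓ : ℕ, ℓ₀ ≤ ℓ → ∀ x ∈ subcell b q ℓ, ∀ y ∈ subcell b q ℓ, ∀ n : Fin d → ℤ, n ≠ 0 →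
        radialPotential f (x - y + (ℓ : ℝ) • intVec b n) ≤
          ENNReal.ofReal ((ℓ : ℝ) ^ (-s)) * g n := by
  obtain ⟨s, hs, K, hK⟩ := hf
  obtain ⟨R, hR⟩ := eventually_atTop.1 hK
  obtain ⟨c, hc, hgap⟩ := exists_gap b hq
  obtain ⟨A, hA, h1, h2⟩ := exists_norm_comparison b
  have hs0 : -s ≤ 0 := by
    have : (0 : ℝ) ≤ d := Nat.cast_nonneg d
    linarith
  have hnorm : ∀ n : Fin d → ℤ, n ≠ 0 → A⁻¹ ≤ ‖intVec b n‖ := by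
    intro n hn
    obtain ⟨i, hi⟩ := Function.ne_iff.1 hn
    rw [inv_le_iff_one_le_mul₀' hA]
    refine le_trans ?_ (h1 _)
    refine le_trans ?_ (norm_le_pi_norm _ i)
    rw [b.equivFun_apply, repr_intVec, Real.norm_eq_abs]
    exact_mod_cast Int.one_le_abs hi
  refine ⟨s, hs, fun n => ENNReal.ofReal (K * c ^ (-s) * ‖intVec b n‖ ^ (-s)), ?_,
    max 1 ⌈R * A / c⌉₊, by simp, fun ℓ hℓ x hx y hy n hn => ?_⟩
  · refine Summable.tsum_ofReal_ne_top (Summable.mul_left _ ?_)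
    have hsum := ZLattice.summable_norm_rpow (L := Φ) (-s) (by
      rw [ZLattice.rank ℝ Φ, finrank_euclideanSpace_fin]
      linarith)
    have hmem : ∀ n, intVec b n ∈ Φ := fun n => hb ▸ (mem_span_iff_intVec b _).2 ⟨n, rfl⟩
    refine hsum.comp_injective (i := fun n => (⟨intVec b n, hmem n⟩ : Φ)) ?_
    intro n n' h
    funext i
    have : b.repr (intVec b n) i = b.repr (intVec b n') i := by
      rw [show intVec b n = intVec b n' from congrArg Subtype.val h]
    simpa using this
  · have hℓ0 : 0 < ℓ := lt_of_lt_of_le (by simp) hℓ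
    have hℓR : (0 : ℝ) < ℓ := by exact_mod_cast hℓ0
    have hg := hgap ℓ hℓ0 x hx y hy n
    have hpos : 0 < ‖intVec b n‖ := (inv_pos.2 hA).trans_le (hnorm n hn)
    have hRℓ : R * A / c ≤ ℓ := (Nat.le_ceil _).trans (by exact_mod_cast (le_max_right _ _).trans hℓ)
    have hRle : (R : ℝ) ≤ ‖x - y + (ℓ : ℝ) • intVec b n‖ := by
      refine le_trans ?_ hg
      refine le_trans ?_ (mul_le_mul_of_nonneg_left (hnorm n hn) (by positivity))
      rw [div_le_iff₀ hc] at hRℓ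
      rw [← div_eq_mul_inv, le_div_iff₀ hA]
      linarith
    refine (hR ‖x - y + (ℓ : ℝ) • intVec b n‖₊ (by exact_mod_cast hRle)).trans ?_
    rw [← ENNReal.ofReal_mul (by positivity), ← ENNReal.ofReal_coe_nnreal]
    refine ENNReal.ofReal_le_ofReal ?_
    push_cast
    calc (K : ℝ) * ‖x - y + (ℓ : ℝ) • intVec b n‖ ^ (-s)
        ≤ K * (c * ℓ * ‖intVec b n‖) ^ (-s) :=
          mul_le_mul_of_nonneg_left
            (Real.rpow_le_rpow_of_nonpos (by positivity) hg hs0) K.coe_nonneg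
      _ = _ := by
          rw [Real.mul_rpow (by positivity) hpos.le, Real.mul_rpow hc.le hℓR.le]
          ring

/-! ### The number of lattice points in a box -/

/-- The coordinates of the box of size `ℓ`, in the tiling with origin `t`, that contains `x`. -/
noncomputable def cellIndex {d : ℕ} (b : Module.Basis (Fin d) ℝ (Euc d)) (ℓ : ℕ) (t x : Euc d) :
    Fin d → ℤ := fun i => ⌊b.repr (x - t) i / ℓ⌋

theorem mem_smul_span_iff {d : ℕ} (b : Module.Basis (Fin d) ℝ (Euc d)) (ℓ : ℕ) (x : Euc d) :
    x ∈ ((ℓ : ℤ) • Submodule.span ℤ (Set.range b)) ↔ ∃ n, x = (ℓ : ℝ) • intVec b n := by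
  rw [Submodule.mem_smul_pointwise_iff_exists]
  constructor
  · rintro ⟨y, hy, rfl⟩
    obtain ⟨n, rfl⟩ := (mem_span_iff_intVec b y).1 hy
    exact ⟨n, by rw [natCast_zsmul, Nat.cast_smul_eq_nsmul]⟩
  · rintro ⟨n, rfl⟩
    exact ⟨_, (mem_span_iff_intVec b _).2 ⟨n, rfl⟩, by
      rw [natCast_zsmul, Nat.cast_smul_eq_nsmul]⟩

theorem isFundDomain_cell {d : ℕ} (b : Module.Basis (Fin d) ℝ (Euc d)) {ℓ : ℕ} (hℓ : 0 < ℓ)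
    (t : Euc d) (z : Fin d → ℤ) :
    IsFundDomain ((ℓ : ℤ) • Submodule.span ℤ (Set.range b)) {x | cellIndex b ℓ t x = z} := by
  have hℓR : (ℓ : ℝ) ≠ 0 := by exact_mod_cast hℓ.ne'
  intro x
  have key : ∀ n : Fin d → ℤ, cellIndex b ℓ t (x + (ℓ : ℝ) • intVec b n) = z ↔
      n = z - cellIndex b ℓ t x := by
    intro n
    have : cellIndex b ℓ t (x + (ℓ : ℝ) • intVec b n) = cellIndex b ℓ t x + n := by
      funext i
      simp only [cellIndex, Pi.add_apply]
      rw [← Int.floor_add_intCast]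
      congr 1
      simp only [map_sub, map_add, map_smul, Finsupp.coe_sub, Finsupp.coe_add, Finsupp.coe_smul,
        Pi.sub_apply, Pi.add_apply, Pi.smul_apply, repr_intVec, smul_eq_mul]
      field_simp
      ring
    rw [this, eq_sub_iff_add_eq, add_comm]
  refine ⟨⟨_, (mem_smul_span_iff b ℓ _).2 ⟨z - cellIndex b ℓ t x, rfl⟩⟩, (key _).2 rfl, ?_⟩
  rintro ⟨v, hv⟩ h
  obtain ⟨n, rfl⟩ := (mem_smul_span_iff b ℓ v).1 hv
  have h' : n = z - cellIndex b ℓ t x := (key n).1 h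
  simp [h']

theorem IsSubZLattice.smul {d : ℕ} {Φ Λ : Submodule ℤ (Euc d)} (hΦ : IsSubZLattice Φ Λ) {m : ℕ}
    (hm : 0 < m) : IsSubZLattice ((m : ℤ) • Φ) Λ := by
  obtain ⟨hle, h1, h2⟩ := hΦ
  have hsub : (m : ℤ) • Φ ≤ Φ := by
    intro x hx
    obtain ⟨y, hy, rfl⟩ := Submodule.mem_smul_pointwise_iff_exists _ _ _ |>.1 hx
    exact Φ.smul_mem _ hy
  have h3 : DiscreteTopology ((m : ℤ) • Φ : Submodule ℤ (Euc d)) :=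
    DiscreteTopology.of_subset h1 hsub
  refine ⟨hsub.trans hle, h3, ⟨?_⟩⟩
  rw [eq_top_iff, ← h2.span_top, Submodule.span_le]
  intro x hx
  have hmR : (m : ℝ) ≠ 0 := by exact_mod_cast hm.ne'
  have hx' : (m : ℝ) • x ∈ (((m : ℤ) • Φ : Submodule ℤ (Euc d)) : Set (Euc d)) := by
    rw [Nat.cast_smul_eq_nsmul, ← natCast_zsmul]
    exact Submodule.smul_mem_pointwise_smul _ _ _ hx
  have := Submodule.smul_mem (Submodule.span ℝ _) (m : ℝ)⁻¹ (Submodule.subset_span (R := ℝ) hx')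
  rwa [inv_smul_smul₀ hmR] at this

/-- The number of points of `Λ` in a fundamental domain of `Φ`. -/
noncomputable def cosetCount {d : ℕ} (Λ Φ : Submodule ℤ (Euc d)) : ℕ :=
  Nat.card ↥((Λ : Set (Euc d)) ∩ Set.range (Quotient.out : Euc d ⧸ Φ → Euc d))

theorem IsFundDomain.card_eq_cosetCount {d : ℕ} {Φ Λ : Submodule ℤ (Euc d)} {Ω : Set (Euc d)}
    (hΩ : IsFundDomain Φ Ω) (hΦ : Φ ≤ Λ) :
    Nat.card ↥((Λ : Set (Euc d)) ∩ Ω) = cosetCount Λ Φ :=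
  hΩ.card_eq (isFundDomain_range_out Φ) hΦ

theorem cosetCount_pos {d : ℕ} {Φ Λ : Submodule ℤ (Euc d)} [DiscreteTopology Λ]
    [IsZLattice ℝ Λ] (hΦ : IsSubZLattice Φ Λ) : 0 < cosetCount Λ Φ := by
  have := finite_inter_fundDomain hΦ (isFundDomain_range_out Φ)
  have := nonempty_inter_fundDomain hΦ.1 (isFundDomain_range_out Φ)
  exact Nat.card_pos

theorem cosetCount_smul {d : ℕ} {Φ Λ : Submodule ℤ (Euc d)} [DiscreteTopology Λ]
    [IsZLattice ℝ Λ] (hΦ : IsSubZLattice Φ Λ) {ℓ : ℕ} (hℓ : 0 < ℓ) :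
    cosetCount Λ ((ℓ : ℤ) • Φ) = ℓ ^ d * cosetCount Λ Φ := by
  have hle := hΦ.1
  obtain ⟨b, hb⟩ : ∃ b : Module.Basis (Fin d) ℝ (Euc d), Submodule.span ℤ (Set.range b) = Φ := by
    obtain ⟨-, _, _⟩ := hΦ
    exact exists_basis_span Φ
  have hℓR : (0 : ℝ) < ℓ := by exact_mod_cast hℓ
  have h1 : IsFundDomain ((ℓ : ℤ) • Φ) {x | cellIndex b ℓ 0 x = 0} :=
    hb ▸ isFundDomain_cell b hℓ 0 0
  have h2 : ∀ z, IsFundDomain Φ {x | cellIndex b 1 0 x = z} := by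
    intro z
    have := isFundDomain_cell b one_pos 0 z
    rwa [Nat.cast_one, one_smul, hb] at this
  have hfin : ∀ z, Finite ↥((Λ : Set (Euc d)) ∩ {x | cellIndex b 1 0 x = z}) :=
    fun z => finite_inter_fundDomain hΦ (h2 z)
  have hidx : ∀ (x : Euc d) (i : Fin d), cellIndex b ℓ 0 x i = 0 ↔
      0 ≤ cellIndex b 1 0 x i ∧ cellIndex b 1 0 x i < ℓ := by
    intro x i
    simp only [cellIndex, sub_zero, Nat.cast_one, div_one]
    rw [Int.floor_eq_zero_iff, Set.mem_Ico, Int.floor_nonneg, Int.floor_lt, div_lt_one hℓR,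
      le_div_iff₀ hℓR, zero_mul, Int.cast_natCast]
  let F : (Σ n : Fin d → Fin ℓ, ↥((Λ : Set (Euc d)) ∩ {x | cellIndex b 1 0 x = fun i => (n i : ℤ)}))
      → ↥((Λ : Set (Euc d)) ∩ {x | cellIndex b ℓ 0 x = 0}) := fun p =>
    ⟨p.2, p.2.2.1, funext fun i => (hidx _ i).2 (by
      rw [show cellIndex b 1 0 p.2.1 = _ from p.2.2.2]
      exact ⟨Int.natCast_nonneg _, Int.ofNat_lt.2 (p.1 i).2⟩)⟩
  have hF : Function.Bijective F := by
    constructor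
    · rintro ⟨n, x, hx⟩ ⟨n', x', hx'⟩ h
      have hxx : x = x' := congrArg Subtype.val h
      subst hxx
      have hn : n = n' := by
        funext i
        have := congrFun (hx.2.symm.trans hx'.2) i
        exact Fin.ext (by exact_mod_cast this)
      subst hn
      rfl
    · rintro ⟨x, hx⟩
      have h3 := fun i => (hidx x i).1 (congrFun hx.2 i)
      refine ⟨⟨fun i => ⟨(cellIndex b 1 0 x i).toNat, by have := h3 i; omega⟩, x, hx.1, ?_⟩, rfl⟩
      funext i
      exact (Int.toNat_of_nonneg (h3 i).1).symm
  rw [← h1.card_eq_cosetCount (hΦ.smul hℓ).1, ← Nat.card_eq_of_bijective F hF, Nat.card_sigma]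
  simp_rw [fun z => (h2 z).card_eq_cosetCount hle]
  simp

/-! ### Cutting a configuration into boxes -/

/-- There is a nonempty finite family of finite configurations in the shrunk box of size `ℓ` whose
average number of points per box is between `α * N` and `β * N` and whose energy per point is at
most `L`. -/
def HasCellFamily {d : ℕ} (f : ℝ≥0 → ℝ≥0∞) (b : Module.Basis (Fin d) ℝ (Euc d)) (q ℓ N : ℕ)
    (α β : ℝ) (L : ℝ≥0∞) : Prop :=
  ∃ (J : Type) (_ : Fintype J) (_ : Nonempty J) (I : J → Type) (_ : ∀ j, Fintype (I j))
    (X : ∀ j, I j → Euc d), (∀ j i, X j i ∈ subcell b q ℓ) ∧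
    α * (Fintype.card J * N) ≤ ∑ j, (Fintype.card (I j) : ℝ) ∧
    ∑ j, (Fintype.card (I j) : ℝ) ≤ β * (Fintype.card J * N) ∧
    ∑ j, configEnergy (radialPotential f) (X j) ≤ L * ∑ j, (Fintype.card (I j) : ℝ≥0∞)

/-- At most one of the points `u - c / q` with `0 ≤ c < q` lies in the last of the `q` equal parts of
a unit interval with integral endpoints. -/
theorem fract_sub_unique {u : ℝ} {q c c' : ℕ} (hc : c < q) (hc' : c' < q)
    (h : 1 - 1 / (q : ℝ) ≤ Int.fract (u - c / q)) (h' : 1 - 1 / (q : ℝ) ≤ Int.fract (u - c' / q)) :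
    c = c' := by
  have hq : (0 : ℝ) < q := by exact_mod_cast (Nat.zero_le c).trans_lt hc
  have h1 := Int.fract_lt_one (u - c / q)
  have h1' := Int.fract_lt_one (u - c' / q)
  have e := Int.self_sub_floor (u - c / q)
  have e' := Int.self_sub_floor (u - c' / q)
  set n := ⌊u - c / q⌋ with hn
  set n' := ⌊u - c' / q⌋ with hn'
  set F := Int.fract (u - c / q)
  set F' := Int.fract (u - c' / q)
  have e2 : (c : ℝ) - c' + q * (n - n') = q * (F' - F) := by
    rw [← e, ← e']
    field_simp
    ring
  have h3 : (q : ℝ) * (F' - F) < 1 := by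
    have : F' - F < 1 / q := by linarith
    rwa [lt_div_iff₀ hq, mul_comm] at this
  have h4 : -1 < (q : ℝ) * (F' - F) := by
    have : F - F' < 1 / q := by linarith
    rw [lt_div_iff₀ hq] at this
    linarith
  rw [← e2] at h3 h4
  have h5 : (c : ℤ) - c' + q * (n - n') < 1 := by exact_mod_cast h3
  have h6 : -1 < (c : ℤ) - c' + q * (n - n') := by exact_mod_cast h4
  have h7 : (c : ℤ) - c' + q * (n - n') = 0 := by omega
  have h8 : (q : ℤ) ∣ c - c' := ⟨-(n - n'), by linarith⟩
  have h9 : (c : ℤ) - c' = 0 := by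
    refine Int.eq_zero_of_abs_lt_dvd h8 ?_
    rw [abs_lt]
    omega
  omega

/-- Among the `q` translates of the tiling by multiples of `ℓ / q` along the diagonal, at most `d`
fail to have a given point in the shrunk part of its box; hence for some translate at most the
fraction `d / q` of the points are lost. -/
theorem exists_shift {d : ℕ} (b : Module.Basis (Fin d) ℝ (Euc d)) {q : ℕ} (hq : 0 < q) {ℓ : ℕ}
    (hℓ : 0 < ℓ) {K : Type} [Fintype K] (x : K → Euc d) :
    ∃ t : Euc d, Fintype.card K * (1 - d / q : ℝ) ≤
      (Nat.card {k : K // ∀ i, Int.fract (b.repr (x k - t) i / ℓ) < 1 - 1 / (q : ℝ)} : ℝ) := by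
  classical
  have hqR : (0 : ℝ) < q := by exact_mod_cast hq
  have hℓR : (0 : ℝ) < ℓ := by exact_mod_cast hℓ
  let t : ℕ → Euc d := fun c => b.equivFun.symm fun _ => ℓ * c / q
  have ht : ∀ c k i, b.repr (x k - t c) i / ℓ = b.repr (x k) i / ℓ - c / q := by
    intro c k i
    have : b.repr (t c) i = ℓ * c / q := by
      rw [← b.equivFun_apply, LinearEquiv.apply_symm_apply]
    rw [map_sub, Finsupp.sub_apply, this]
    field_simp
  let good : ℕ → K → Prop := fun c k =>
    ∀ i, Int.fract (b.repr (x k - t c) i / ℓ) < 1 - 1 / (q : ℝ)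
  have hbad : ∀ k, ((Finset.range q).filter fun c => ¬ good c k).card ≤ d := by
    intro k
    have hsub : ((Finset.range q).filter fun c => ¬ good c k) ⊆ Finset.univ.biUnion fun i : Fin d =>
        (Finset.range q).filter fun c =>
          1 - 1 / (q : ℝ) ≤ Int.fract (b.repr (x k) i / ℓ - c / q) := by
      intro c hc
      simp only [Finset.mem_filter, good, not_forall, not_lt, ht] at hc
      obtain ⟨h1, i, hi⟩ := hc
      simp only [Finset.mem_biUnion, Finset.mem_filter, Finset.mem_univ, true_and]
      exact ⟨i, h1, hi⟩
    refine (Finset.card_le_card hsub).trans (Finset.card_biUnion_le.trans ?_)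
    calc _ ≤ ∑ _i : Fin d, 1 := by
          refine Finset.sum_le_sum fun i _ => Finset.card_le_one.2 fun c hc c' hc' => ?_
          rw [Finset.mem_filter, Finset.mem_range] at hc hc'
          exact fract_sub_unique hc.1 hc'.1 hc.2 hc'.2
      _ = d := by simp
  have hsum : ∑ c ∈ Finset.range q, (Fintype.card K * (1 - d / q : ℝ)) ≤
      ∑ c ∈ Finset.range q, ((Finset.univ.filter fun k => good c k).card : ℝ) := by
    have h1 : ∀ k, (q : ℝ) - d ≤ ((Finset.range q).filter fun c => good c k).card := by
      intro k
      have h2 := Finset.card_filter_add_card_filter_not (s := Finset.range q) (fun c => good c k)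
      rw [Finset.card_range] at h2
      have h3 : (q : ℝ) ≤ ((Finset.range q).filter fun c => good c k).card + d := by
        exact_mod_cast h2 ▸ Nat.add_le_add_left (hbad k) _
      linarith
    calc _ = ∑ _k : K, ((q : ℝ) - d) := by
          rw [Finset.sum_const, Finset.sum_const, Finset.card_range, Finset.card_univ,
            nsmul_eq_mul, nsmul_eq_mul]
          field_simp
      _ ≤ ∑ k : K, (((Finset.range q).filter fun c => good c k).card : ℝ) :=
          Finset.sum_le_sum fun k _ => h1 k
      _ = _ := by
          simp_rw [Finset.card_filter]
          push_cast
          exact Finset.sum_comm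
  obtain ⟨c, -, hc⟩ := Finset.exists_le_of_sum_le (Finset.nonempty_range_iff.2 hq.ne') hsum
  refine ⟨t c, hc.trans (le_of_eq ?_)⟩
  rw [Nat.card_eq_fintype_card, Fintype.card_subtype]

theorem exists_norm_sub_le_of_cellIndex_eq {d : ℕ} (b : Module.Basis (Fin d) ℝ (Euc d)) {ℓ : ℕ}
    (hℓ : 0 < ℓ) : ∃ D : ℝ, 0 ≤ D ∧ ∀ t x y, cellIndex b ℓ t x = cellIndex b ℓ t y →
      ‖x - y‖ ≤ D := by
  obtain ⟨A, hA, -, h2⟩ := exists_norm_comparison b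
  have hℓR : (0 : ℝ) < ℓ := by exact_mod_cast hℓ
  refine ⟨A * ℓ, by positivity, fun t x y h => (h2 _).trans ?_⟩
  gcongr
  rw [pi_norm_le_iff_of_nonneg hℓR.le]
  intro i
  have h3 := Int.abs_sub_lt_one_of_floor_eq_floor (congrFun h i)
  rw [← sub_div, abs_div, abs_of_pos hℓR, div_lt_one hℓR] at h3
  have h4 : b.repr (x - t) i - b.repr (y - t) i = b.repr (x - y) i := by simp
  rw [b.equivFun_apply, Real.norm_eq_abs, ← h4]
  exact h3.le

/-- The boxes of size `ℓ` that are needed to cover a ball have about as many points of `Λ` in total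
as the ball. In this form volumes of boxes are not needed. -/
theorem card_mul_cosetCount_bounds {d : ℕ} {Λ : Submodule ℤ (Euc d)} [DiscreteTopology Λ]
    [IsZLattice ℝ Λ] (b : Module.Basis (Fin d) ℝ (Euc d))
    (hΦ : IsSubZLattice (Submodule.span ℤ (Set.range b)) Λ) {ℓ : ℕ} (hℓ : 0 < ℓ) {D : ℝ}
    (hD : ∀ t x y, cellIndex b ℓ t x = cellIndex b ℓ t y → ‖x - y‖ ≤ D) (t : Euc d) (r : ℝ) :
    ∃ J : Finset (Fin d → ℤ), (∀ x ∈ Metric.ball (0 : Euc d) r, cellIndex b ℓ t x ∈ J) ∧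
      J.card * cosetCount Λ ((ℓ : ℤ) • Submodule.span ℤ (Set.range b)) ≤
        ballCount (latticeConfig Λ) (r + 2 * D) ∧
      ballCount (latticeConfig Λ) r ≤
        J.card * cosetCount Λ ((ℓ : ℤ) • Submodule.span ℤ (Set.range b)) := by
  classical
  have hcell := isFundDomain_cell b hℓ t
  have hfin := fun z => finite_inter_fundDomain (hΦ.smul hℓ) (hcell z)
  have hne := fun z => nonempty_inter_fundDomain (hΦ.smul hℓ).1 (hcell z)
  have hcard := fun z => (hcell z).card_eq_cosetCount (hΦ.smul hℓ).1
  have hS := finite_lattice_ball Λ 0 (r + D)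
  -- the boxes that contain a point of `Λ` near the ball
  set J := hS.toFinset.image fun v : Λ => cellIndex b ℓ t v
  have hJ : ∀ x ∈ Metric.ball (0 : Euc d) r, cellIndex b ℓ t x ∈ J := by
    intro x hx
    obtain ⟨y, hy, hy'⟩ := hne (cellIndex b ℓ t x)
    refine Finset.mem_image.2 ⟨⟨y, hy⟩, ?_, hy'⟩
    have := hD t y x hy'
    simp only [Set.Finite.mem_toFinset, Set.mem_ofPred_eq, Metric.mem_ball, dist_zero_right] at hx ⊢
    calc ‖y‖ = ‖x + (y - x)‖ := by simp
      _ ≤ ‖x‖ + ‖y - x‖ := norm_add_le _ _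
      _ < r + D := by linarith
  have hsig : J.card * cosetCount Λ ((ℓ : ℤ) • Submodule.span ℤ (Set.range b)) =
      Nat.card (Σ z : J, ↥((Λ : Set (Euc d)) ∩ {x | cellIndex b ℓ t x = z})) := by
    rw [Nat.card_sigma]
    simp_rw [hcard]
    simp
  refine ⟨J, hJ, ?_, ?_⟩
  · rw [hsig]
    have : Finite {v : Λ // latticeConfig Λ v ∈ Metric.ball (0 : Euc d) (r + 2 * D)} :=
      (finite_lattice_ball Λ 0 (r + 2 * D)).to_subtype
    refine Nat.card_le_card_of_injective (fun p => ⟨⟨p.2, p.2.2.1⟩, ?_⟩) ?_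
    · obtain ⟨⟨z, hz⟩, y, hy, hy'⟩ := p
      obtain ⟨v, hv, hvz⟩ := Finset.mem_image.1 hz
      have h1 : ‖y - (v : Euc d)‖ ≤ D := hD t y v (hy'.trans hvz.symm)
      simp only [Set.Finite.mem_toFinset, Set.mem_ofPred_eq, Metric.mem_ball,
        dist_zero_right, latticeConfig] at hv ⊢
      calc ‖y‖ = ‖(v : Euc d) + (y - v)‖ := by simp
        _ ≤ ‖(v : Euc d)‖ + ‖y - v‖ := norm_add_le _ _
        _ < r + 2 * D := by linarith
    · rintro ⟨⟨z, hz⟩, y, hy, hy'⟩ ⟨⟨z', hz'⟩, y', hy1, hy1'⟩ h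
      have h1 : y = y' := congrArg (fun v => (v.1 : Euc d)) h
      subst h1
      obtain rfl : z = z' := hy'.symm.trans hy1'
      rfl
  · rw [hsig]
    refine Nat.card_le_card_of_injective
      (fun v : {v : Λ // latticeConfig Λ v ∈ Metric.ball (0 : Euc d) r} =>
        (⟨⟨cellIndex b ℓ t v.1, hJ _ v.2⟩, v.1, v.1.2, rfl⟩ :
          Σ z : J, ↥((Λ : Set (Euc d)) ∩ {x | cellIndex b ℓ t x = z}))) ?_
    intro v v' h
    refine Subtype.ext (Subtype.ext ?_)
    exact congrArg (fun p : (Σ z : J, ↥((Λ : Set (Euc d)) ∩ {x | cellIndex b ℓ t x = z})) =>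
      (p.2 : Euc d)) h

/-- A large ball of a configuration, cut into boxes. Shrinking the boxes leaves at least the
proportion `1 - d / q` of the points, so the energy per point grows at most by the inverse of this
factor. -/
theorem hasCellFamily_of_lowerEnergy_lt {d : ℕ} {f : ℝ≥0 → ℝ≥0∞} {Λ : Submodule ℤ (Euc d)}
    [DiscreteTopology Λ] [IsZLattice ℝ Λ] {ρ : ℝ} (hρ : 0 < ρ)
    (hΛ : HasDensity (latticeConfig Λ) ρ) (b : Module.Basis (Fin d) ℝ (Euc d))
    (hΦ : IsSubZLattice (Submodule.span ℤ (Set.range b)) Λ) {κ : Type} {y : κ → Euc d} {ρ' : ℝ}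
    (hρ' : 0 < ρ') (hy : IsInfiniteConfig y) (hyρ : HasDensity y ρ') {L : ℝ≥0∞}
    (hL : lowerEnergy f y < L) {q : ℕ} (hq : d < q) {ℓ : ℕ} (hℓ : 0 < ℓ) {α β : ℝ}
    (hα : α < (1 - d / q : ℝ) * (ρ' / ρ)) (hβ : ρ' / ρ < β) :
    HasCellFamily f b q ℓ (cosetCount Λ ((ℓ : ℤ) • Submodule.span ℤ (Set.range b))) α β
      (L / ENNReal.ofReal (1 - d / q : ℝ)) := by
  classical
  have hq0 : 0 < q := (Nat.zero_le d).trans_lt hq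
  have hqR : (0 : ℝ) < q := by exact_mod_cast hq0
  have hℓR : (0 : ℝ) < ℓ := by exact_mod_cast hℓ
  set θ : ℝ := 1 - d / q with hθ
  have hθ0 : 0 < θ := by
    rw [hθ, sub_pos, div_lt_one hqR]
    exact_mod_cast hq
  obtain ⟨D, hD0, hD⟩ := exists_norm_sub_le_of_cellIndex_eq b hℓ
  have e1 := (hΛ.tendsto_ballCount_div hyρ hρ.ne' (2 * D) 0).eventually
    (lt_mem_nhds (show α / θ < ρ' / ρ by rwa [div_lt_iff₀' hθ0]))
  have e2 := (hΛ.tendsto_ballCount_div hyρ hρ.ne' 0 0).eventually (gt_mem_nhds hβ)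
  obtain ⟨r, hrL, hr1, hr2, hr3, hr4, hr5, hr6⟩ :=
    ((frequently_lt_of_liminf_lt (by isBoundedDefault) hL).and_eventually
    (e1.and (e2.and ((hΛ.eventually_ballCount_pos hρ (2 * D)).and
      ((hΛ.eventually_ballCount_pos hρ 0).and ((hyρ.eventually_ballCount_pos hρ' 0).and
        (eventually_gt_atTop 0))))))).exists
  rw [add_zero] at hr1 hr2 hr4 hr5
  rw [lt_div_iff₀ (by exact_mod_cast hr3)] at hr1
  rw [div_lt_iff₀ (by exact_mod_cast hr4)] at hr2
  have := hy.finite_ball r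
  have := Fintype.ofFinite {i : κ // y i ∈ Metric.ball (0 : Euc d) r}
  set K := {i : κ // y i ∈ Metric.ball (0 : Euc d) r} with hK
  have hcK : ballCount y r = Fintype.card K := Nat.card_eq_fintype_card
  have hcK0 : (Nat.card K : ℝ≥0∞) ≠ 0 := by
    have : Nat.card K ≠ 0 := hr5.ne'
    exact_mod_cast this
  obtain ⟨t, ht⟩ := exists_shift b hq0 hℓ (restrictBall y r)
  obtain ⟨J, hJ, hJ1, hJ2⟩ := card_mul_cosetCount_bounds b hΦ hℓ hD t r
  set N := cosetCount Λ ((ℓ : ℤ) • Submodule.span ℤ (Set.range b)) with hN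
  let good : K → Prop := fun k =>
    ∀ i, Int.fract (b.repr (restrictBall y r k - t) i / ℓ) < 1 - 1 / (q : ℝ)
  let I : J → Type := fun j => {k : K // good k ∧ cellIndex b ℓ t (restrictBall y r k) = j}
  let X : ∀ j, I j → Euc d := fun j k => restrictBall y r k.1 - t - (ℓ : ℝ) • intVec b j
  have hsumcard : ∑ j : J, Fintype.card (I j) = Nat.card {k : K // good k} := by
    rw [← Fintype.card_sigma, ← Nat.card_eq_fintype_card]
    refine Nat.card_congr ⟨fun p => ⟨p.2.1, p.2.2.1⟩,
      fun k => ⟨⟨cellIndex b ℓ t (restrictBall y r k.1), hJ _ k.1.2⟩, k.1, k.2, rfl⟩, ?_, ?_⟩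
    · rintro ⟨⟨z, hz⟩, k, hk, hkz⟩
      dsimp only at hkz
      subst hkz
      rfl
    · intro k
      rfl
  have hsumR : ∑ j : J, (Fintype.card (I j) : ℝ) = Nat.card {k : K // good k} := by
    exact_mod_cast hsumcard
  have hsumE : ∑ j : J, (Fintype.card (I j) : ℝ≥0∞) = Nat.card {k : K // good k} := by
    exact_mod_cast hsumcard
  have hgood : (Nat.card {k : K // good k} : ℝ) ≤ Fintype.card K := by
    rw [← Nat.card_eq_fintype_card]
    exact_mod_cast Finite.card_subtype_le good
  have hJne : Nonempty J := ⟨⟨_, hJ 0 (by simpa using hr6)⟩⟩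
  refine ⟨J, inferInstance, hJne, I, inferInstance, X, ?_, ?_, ?_, ?_⟩
  · rintro j ⟨k, hk, hkj⟩ i
    have h1 : b.repr (X j ⟨k, hk, hkj⟩) i =
        ℓ * Int.fract (b.repr (restrictBall y r k - t) i / ℓ) := by
      have h2 : b.repr (X j ⟨k, hk, hkj⟩) i = b.repr (restrictBall y r k - t) i - ℓ * j.1 i := by
        simp [X]
      rw [h2, ← hkj, cellIndex, Int.fract]
      field_simp
    rw [h1]
    exact ⟨mul_nonneg hℓR.le (Int.fract_nonneg _), mul_lt_mul_of_pos_left (hk i) hℓR⟩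
  · rw [hsumR, Fintype.card_coe]
    refine le_trans ?_ ht
    have h3 : ((J.card : ℝ) * N) ≤ ballCount (latticeConfig Λ) (r + 2 * D) := by exact_mod_cast hJ1
    rcases le_total α 0 with h | h
    · exact (mul_nonpos_of_nonpos_of_nonneg h (by positivity)).trans
        (mul_nonneg (Nat.cast_nonneg _) hθ0.le)
    · refine (mul_le_mul_of_nonneg_left h3 h).trans ?_
      rw [hcK, div_mul_eq_mul_div, div_lt_iff₀ hθ0] at hr1
      exact hr1.le
  · rw [hsumR, Fintype.card_coe]
    have hβ0 : 0 ≤ β := (div_pos hρ' hρ).le.trans hβ.le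
    refine hgood.trans (le_trans ?_ (mul_le_mul_of_nonneg_left
      (show (ballCount (latticeConfig Λ) r : ℝ) ≤ J.card * N by exact_mod_cast hJ2) hβ0))
    rw [hcK] at hr2
    exact hr2.le
  · rw [hsumE]
    have h4 : configEnergy (radialPotential f) (restrictBall y r) ≤ L * Nat.card K := by
      have := hrL.le
      rwa [energyPerPoint, ENNReal.div_le_iff hcK0 (by simp)] at this
    have h5 : ∑ j : J, configEnergy (radialPotential f) (X j) ≤
        configEnergy (radialPotential f) (restrictBall y r) := by
      have h6 : ∀ j, configEnergy (radialPotential f) (X j) =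
          configEnergy (radialPotential f) (fun k : I j => restrictBall y r k.1) := by
        intro j
        rw [← configEnergy_add_const _ _ (t + (ℓ : ℝ) • intVec b j)]
        congr 1
        funext k
        simp only [X]
        abel
      simp_rw [h6]
      rw [← tsum_fintype (L := .unconditional _)]
      refine (sum_configEnergy_le_configEnergy_sigma _ _).trans ?_
      refine configEnergy_comp_le (radialPotential f) (restrictBall y r)
        (e := fun p : Σ j, I j => p.2.1) ?_
      rintro ⟨⟨z, hz⟩, k, hk, hkz⟩ ⟨⟨z', hz'⟩, k', hk', hkz'⟩ h
      obtain rfl : k = k' := h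
      obtain rfl : z = z' := hkz.symm.trans hkz'
      rfl
    refine h5.trans (h4.trans ?_)
    rw [ENNReal.mul_div_right_comm.symm, ENNReal.le_div_iff_mul_le
      (Or.inl (by simpa using hθ0)) (Or.inl ENNReal.ofReal_ne_top), mul_assoc]
    gcongr
    rw [Nat.card_eq_fintype_card, ← ENNReal.ofReal_natCast, ← ENNReal.ofReal_natCast,
      ← ENNReal.ofReal_mul (by positivity)]
    exact ENNReal.ofReal_le_ofReal ht

/-- Combining `a` parts of one family with one part of another. -/
theorem HasCellFamily.mix {d : ℕ} {f : ℝ≥0 → ℝ≥0∞} {b : Module.Basis (Fin d) ℝ (Euc d)}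
    {q ℓ N : ℕ} {α₁ α₂ β₁ β₂ l₁ l₂ l : ℝ}
    (h₁ : HasCellFamily f b q ℓ N α₁ β₁ (ENNReal.ofReal l₁))
    (h₂ : HasCellFamily f b q ℓ N α₂ β₂ (ENNReal.ofReal l₂)) (a : ℕ) (hl₁ : 0 ≤ l₁) (hl₂ : 0 ≤ l₂)
    (hl : l₁ ≤ l) (hmix : β₂ * l₂ ≤ (l - l₁) * a * α₁) :
    HasCellFamily f b q ℓ N ((a * α₁ + α₂) / (a + 1)) ((a * β₁ + β₂) / (a + 1))
      (ENNReal.ofReal l) := by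
  obtain ⟨J₁, _, _, I₁, F₁, X₁, hX₁, hα₁, hβ₁, hE₁⟩ := h₁
  obtain ⟨J₂, _, _, I₂, F₂, X₂, hX₂, hα₂, hβ₂, hE₂⟩ := h₂
  have ha : (0 : ℝ) < a + 1 := by positivity
  set n₁ : ℝ := ∑ j, (Fintype.card (I₁ j) : ℝ) with hn₁
  set n₂ : ℝ := ∑ j, (Fintype.card (I₂ j) : ℝ) with hn₂
  set c₁ : ℝ := (Fintype.card J₁ : ℝ) with hc₁
  set c₂ : ℝ := (Fintype.card J₂ : ℝ) with hc₂
  have hn₁0 : 0 ≤ n₁ := Finset.sum_nonneg fun _ _ => Nat.cast_nonneg _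
  have hn₂0 : 0 ≤ n₂ := Finset.sum_nonneg fun _ _ => Nat.cast_nonneg _
  have hc₁0 : 0 ≤ c₁ := Nat.cast_nonneg _
  have hc₂0 : 0 ≤ c₂ := Nat.cast_nonneg _
  let I : (J₁ × J₂ × Fin a) ⊕ (J₂ × J₁) → Type := fun j =>
    Sum.rec (fun p => I₁ p.1) (fun p => I₂ p.1) j
  let inst : ∀ j, Fintype (I j) := fun j =>
    Sum.rec (motive := fun j => Fintype (I j)) (fun p => (inferInstance : Fintype (I₁ p.1)))
      (fun p => (inferInstance : Fintype (I₂ p.1))) j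
  let X : ∀ j, I j → Euc d := fun j =>
    Sum.rec (motive := fun j => I j → Euc d) (fun p => X₁ p.1) (fun p => X₂ p.1) j
  have hsum : ∑ j : (J₁ × J₂ × Fin a) ⊕ (J₂ × J₁), (@Fintype.card (I j) (inst j) : ℝ) = c₂ * a * n₁ + c₁ * n₂ := by
    have key : ∀ (G : J₁ → ℝ) (H : J₂ → ℝ), ∑ p : J₁ × J₂ × Fin a, G p.1 + ∑ p : J₂ × J₁, H p.1 =
        c₂ * a * ∑ j, G j + c₁ * ∑ j, H j := by
      intro G H
      rw [Fintype.sum_prod_type, Fintype.sum_prod_type]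
      simp only [Finset.sum_const, Finset.card_univ, Fintype.card_prod, Fintype.card_fin,
        nsmul_eq_mul, ← Finset.mul_sum]
      push_cast
      rfl
    rw [Fintype.sum_sum_type]
    exact key (fun j => Fintype.card (I₁ j)) fun j => Fintype.card (I₂ j)
  have hsumE : ∑ j, configEnergy (radialPotential f) (X j) =
      ENNReal.ofReal (c₂ * a) * ∑ j, configEnergy (radialPotential f) (X₁ j) +
        ENNReal.ofReal c₁ * ∑ j, configEnergy (radialPotential f) (X₂ j) := by
    rw [Fintype.sum_sum_type, Fintype.sum_prod_type, Fintype.sum_prod_type]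
    have e1 : ∀ p, configEnergy (radialPotential f) (X (Sum.inl p)) =
      configEnergy (radialPotential f) (X₁ p.1) := fun p => rfl
    have e2 : ∀ p, configEnergy (radialPotential f) (X (Sum.inr p)) =
      configEnergy (radialPotential f) (X₂ p.1) := fun p => rfl
    simp only [e1, e2, Finset.sum_const, Finset.card_univ, Fintype.card_prod, Fintype.card_fin,
      nsmul_eq_mul, ← Finset.mul_sum]
    rw [hc₂, hc₁, ENNReal.ofReal_mul (Nat.cast_nonneg _)]
    simp only [ENNReal.ofReal_natCast]
    push_cast
    rfl
  have hcast : ∀ {J : Type} [Fintype J] (I : J → Type) [∀ j, Fintype (I j)],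
      ∑ j, (Fintype.card (I j) : ℝ≥0∞) = ENNReal.ofReal (∑ j, (Fintype.card (I j) : ℝ)) := by
    intro J _ I _
    rw [ENNReal.ofReal_sum_of_nonneg fun _ _ => Nat.cast_nonneg _]
    simp
  have hcard : (Fintype.card ((J₁ × J₂ × Fin a) ⊕ (J₂ × J₁)) : ℝ) = c₁ * c₂ * (a + 1) := by
    rw [Fintype.card_sum, Fintype.card_prod, Fintype.card_prod, Fintype.card_prod, Fintype.card_fin]
    push_cast
    ring
  refine ⟨_, inferInstance, inferInstance, I, inst, X, ?_, ?_, ?_, ?_⟩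
  · rintro (p | p) i
    · exact hX₁ p.1 i
    · exact hX₂ p.1 i
  · rw [hsum, hcard]
    have e1 := mul_le_mul_of_nonneg_left hα₁ (by positivity : 0 ≤ c₂ * a)
    have e2 := mul_le_mul_of_nonneg_left hα₂ hc₁0
    calc _ = c₂ * a * (α₁ * (c₁ * N)) + c₁ * (α₂ * (c₂ * N)) := by field_simp
      _ ≤ _ := by linarith
  · rw [hsum, hcard]
    have e1 := mul_le_mul_of_nonneg_left hβ₁ (by positivity : 0 ≤ c₂ * a)
    have e2 := mul_le_mul_of_nonneg_left hβ₂ hc₁0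
    calc _ ≤ c₂ * a * (β₁ * (c₁ * N)) + c₁ * (β₂ * (c₂ * N)) := by linarith
      _ = _ := by field_simp
  · rw [hcast] at hE₁ hE₂ ⊢
    rw [hsum, hsumE]
    rw [← ENNReal.ofReal_mul hl₁] at hE₁
    rw [← ENNReal.ofReal_mul hl₂] at hE₂
    rw [← ENNReal.ofReal_mul (hl₁.trans hl)]
    have e1 : c₁ * (l₂ * n₂) ≤ (l - l₁) * (c₂ * a * n₁) := by
      calc c₁ * (l₂ * n₂) ≤ c₁ * (l₂ * (β₂ * (c₂ * N))) := by gcongr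
        _ = (c₁ * c₂ * N) * (β₂ * l₂) := by ring
        _ ≤ (c₁ * c₂ * N) * ((l - l₁) * a * α₁) := by gcongr
        _ = (l - l₁) * (c₂ * a * (α₁ * (c₁ * N))) := by ring
        _ ≤ _ := by
          refine mul_le_mul_of_nonneg_left ?_ (sub_nonneg.2 hl)
          exact mul_le_mul_of_nonneg_left hα₁ (by positivity)
    calc _ ≤ ENNReal.ofReal (c₂ * a) * ENNReal.ofReal (l₁ * n₁) +
          ENNReal.ofReal c₁ * ENNReal.ofReal (l₂ * n₂) := by gcongr
      _ = ENNReal.ofReal (c₂ * a * (l₁ * n₁) + c₁ * (l₂ * n₂)) := by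
          rw [← ENNReal.ofReal_mul (by positivity), ← ENNReal.ofReal_mul hc₁0,
            ENNReal.ofReal_add (by positivity) (by positivity)]
      _ ≤ _ := by
          refine ENNReal.ofReal_le_ofReal ?_
          have h0 : 0 ≤ l * (c₁ * n₂) := mul_nonneg (hl₁.trans hl) (by positivity)
          nlinarith

/-! ### Assembling boxes into a configuration on a torus -/

/-- Filling `card J * M` of the `k ^ d` boxes of a large box with the members of a family, each used
`M` times, in an arrangement for which the interaction between the boxes is at most the average
over all arrangements. -/
theorem exists_assembly {d : ℕ} {f : ℝ≥0 → ℝ≥0∞} {b : Module.Basis (Fin d) ℝ (Euc d)}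
    {q ℓ : ℕ} {c : ℝ≥0∞} {g : (Fin d → ℤ) → ℝ≥0∞}
    (hg : ∀ x ∈ subcell b q ℓ, ∀ y ∈ subcell b q ℓ, ∀ n : Fin d → ℤ, n ≠ 0 →
        radialPotential f (x - y + (ℓ : ℝ) • intVec b n) ≤ c * g n)
    {J : Type} [Fintype J] {I : J → Type} [∀ j, Fintype (I j)] {X : ∀ j, I j → Euc d}
    (hX : ∀ j i, X j i ∈ subcell b q ℓ) {M k : ℕ} (hJM : 2 ≤ Fintype.card J * M)
    (hk : Fintype.card J * M ≤ k ^ d) :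
    ∃ (W : Type) (_ : Fintype W) (w : W → Euc d), Fintype.card W = M * ∑ j, Fintype.card (I j) ∧
      (∀ i j, 0 ≤ b.repr (w i) j ∧ b.repr (w i) j ≤ ℓ * (k - 1 / q : ℝ)) ∧
      configEnergy (radialPotential f) w ≤ M * ∑ j, configEnergy (radialPotential f) (X j) +
        ((M * ∑ j, (Fintype.card (I j) : ℝ≥0∞)) ^ 2 * (c * ∑' n, g n)) /
          (Fintype.card J * M - 1 : ℕ) := by
  classical
  have hcardZ : Fintype.card (J × Fin M) = Fintype.card J * M := by simp
  obtain ⟨p⟩ := Function.Embedding.nonempty_of_card_le (α := J × Fin M) (β := Fin d → Fin k)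
    (by simpa using hk)
  have : Nontrivial (J × Fin M) := by
    rw [← Fintype.one_lt_card_iff_nontrivial]
    omega
  let pos : J × Fin M → Fin d → ℤ := fun z i => p z i
  have hpos : Function.Injective pos := by
    intro z z' h
    refine p.injective (funext fun i => Fin.ext ?_)
    exact Nat.cast_injective (R := ℤ) (congrFun h i)
  obtain ⟨σ, hσ⟩ := exists_perm_interaction_le (Z := J × Fin M)
    (fun z => (Fintype.card (I z.1) : ℝ≥0∞)) (fun z z' => c * g (pos z - pos z')) (c * ∑' n, g n) (by
      intro z
      rw [← Finset.mul_sum]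
      gcongr
      rw [← tsum_fintype (L := .unconditional _)]
      exact ENNReal.tsum_comp_le_tsum_of_injective
        (f := fun z' => pos z - pos z') (sub_right_injective.comp hpos) g)
  have hsumZ : ∀ F : J → ℝ≥0∞, ∑ z : J × Fin M, F z.1 = M * ∑ j, F j := by
    intro F
    rw [Fintype.sum_prod_type]
    simp [Finset.mul_sum]
  let Y : ∀ z : J × Fin M, I (σ z).1 → Euc d := fun z i => X (σ z).1 i + (ℓ : ℝ) • intVec b (pos z)
  refine ⟨Σ z : J × Fin M, I (σ z).1, inferInstance, fun i => Y i.1 i.2, ?_, ?_, ?_⟩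
  · rw [Fintype.card_sigma, Equiv.sum_comp σ fun z => Fintype.card (I z.1), Fintype.sum_prod_type,
      Finset.mul_sum]
    refine Finset.sum_congr rfl fun j _ => ?_
    change ∑ _x : Fin M, Fintype.card (I j) = _
    simp
  · rintro ⟨z, i⟩ j
    have h1 : b.repr (Y z i) j = b.repr (X (σ z).1 i) j + ℓ * (p z j : ℕ) := by
      simp [Y, pos]
    obtain ⟨h2, h3⟩ := hX _ i j
    have h4 : ((p z j : ℕ) : ℝ) + 1 ≤ k := by exact_mod_cast (p z j).2
    have h5 : (ℓ : ℝ) * (p z j : ℕ) + ℓ ≤ ℓ * k := by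
      nlinarith [(Nat.cast_nonneg ℓ : (0 : ℝ) ≤ ℓ)]
    dsimp only
    rw [h1]
    refine ⟨by positivity, ?_⟩
    rw [mul_sub] at h3 ⊢
    linarith
  · rw [configEnergy_sigma, tsum_fintype]
    refine add_le_add (le_of_eq ?_) ?_
    · simp only [Y, configEnergy_add_const]
      rw [Equiv.sum_comp σ fun z : J × Fin M => configEnergy (radialPotential f) (X z.1),
        hsumZ fun j => configEnergy (radialPotential f) (X j)]
    · have hne : ((Fintype.card J * M - 1 : ℕ) : ℝ≥0∞) ≠ 0 := by
        have : Fintype.card J * M - 1 ≠ 0 := by omega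
        exact_mod_cast this
      rw [ENNReal.le_div_iff_mul_le (Or.inl hne) (Or.inl (ENNReal.natCast_ne_top _)), mul_comm,
        ← hsumZ fun j => (Fintype.card (I j) : ℝ≥0∞), ← hcardZ]
      refine le_trans (mul_le_mul_right ?_ _) hσ
      rw [tsum_fintype]
      refine Finset.sum_le_sum fun z _ => ?_
      rw [tsum_fintype]
      refine Finset.sum_le_sum fun z' _ => ?_
      split_ifs with h
      · exact le_rfl
      · have hn : pos z - pos z' ≠ 0 := fun h0 => h (hpos (sub_eq_zero.1 h0)).symm
        calc _ ≤ ∑' _i : I (σ z).1, ∑' _i' : I (σ z').1, c * g (pos z - pos z') := by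
              refine ENNReal.tsum_le_tsum fun i => ENNReal.tsum_le_tsum fun i' => ?_
              have := hg _ (hX _ i) _ (hX _ i') _ hn
              convert this using 2
              have hsub : intVec b (pos z - pos z') = intVec b (pos z) - intVec b (pos z') :=
                b.ext_elem fun j => by simp
              simp only [Y, hsub, smul_sub]
              abel
          _ = _ := by
              simp [tsum_fintype, mul_assoc]

open Classical in
/-- The interaction of a point with the nontrivial translates of another one on a torus, if both
points lie in the shrunk fundamental box. -/
theorem tsum_torus_images_le {d : ℕ} {f : ℝ≥0 → ℝ≥0∞} {b : Module.Basis (Fin d) ℝ (Euc d)}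
    {q m : ℕ} {c : ℝ≥0∞} {g : (Fin d → ℤ) → ℝ≥0∞}
    (hg : ∀ x ∈ subcell b q m, ∀ y ∈ subcell b q m, ∀ n : Fin d → ℤ, n ≠ 0 →
        radialPotential f (x - y + (m : ℝ) • intVec b n) ≤ c * g n)
    {x y : Euc d} (hx : x ∈ subcell b q m) (hy : y ∈ subcell b q m) :
    (∑' v : ((m : ℤ) • Submodule.span ℤ (Set.range b) : Submodule ℤ (Euc d)),
      if v = 0 then 0 else radialPotential f (x - y + (v : Euc d))) ≤ c * ∑' n, g n := by
  choose n hn using fun v : ((m : ℤ) • Submodule.span ℤ (Set.range b) : Submodule ℤ (Euc d)) =>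
    (mem_smul_span_iff b m v).1 v.2
  have hinj : Function.Injective n := fun v v' h => Subtype.ext (by rw [hn, hn v', h])
  rw [← ENNReal.tsum_mul_left]
  refine le_trans ?_ (ENNReal.tsum_comp_le_tsum_of_injective hinj _)
  refine ENNReal.tsum_le_tsum fun v => ?_
  split_ifs with h
  · exact zero_le
  · conv_lhs => rw [hn v]
    refine hg _ hx _ hy _ fun h0 => h (Subtype.ext ?_)
    rw [hn v, h0]
    have : intVec b 0 = 0 := b.ext_elem fun j => by simp
    simp [this]

theorem configEnergy_torus_le {d : ℕ} {f : ℝ≥0 → ℝ≥0∞} {b : Module.Basis (Fin d) ℝ (Euc d)}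
    {q m : ℕ} {c : ℝ≥0∞} {g : (Fin d → ℤ) → ℝ≥0∞}
    (hg : ∀ x ∈ subcell b q m, ∀ y ∈ subcell b q m, ∀ n : Fin d → ℤ, n ≠ 0 →
        radialPotential f (x - y + (m : ℝ) • intVec b n) ≤ c * g n)
    {W : Type} [Fintype W] {w : W → Euc d} (hw : ∀ i, w i ∈ subcell b q m) :
    configEnergy (periodizedPotential f ((m : ℤ) • Submodule.span ℤ (Set.range b))) w ≤
      configEnergy (radialPotential f) w + (Fintype.card W : ℝ≥0∞) ^ 2 * (c * ∑' n, g n) :=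
  configEnergy_periodized_le f _ w _ fun i j => tsum_torus_images_le hg (hw i) (hw j)

theorem eventually_torus_energy_le {d : ℕ} (hd : 0 < d) {s : ℝ} (hs : (d : ℝ) < s) {A B L n N : ℝ}
    (hN : 0 < N) (hAL : A < L) :
    ∀ᶠ m : ℕ in atTop, ((m : ℝ) ^ d * N + n) * A + ((m : ℝ) ^ d * N + n) ^ 2 * ((m : ℝ) ^ (-s) * B) ≤
      L * ((m : ℝ) ^ d * N) := by
  have h1 : Tendsto (fun m : ℕ => n / ((m : ℝ) ^ d * N)) atTop (𝓝 0) :=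
    tendsto_const_nhds.div_atTop (((tendsto_pow_atTop hd.ne').comp
      tendsto_natCast_atTop_atTop).atTop_mul_const hN)
  have h2 : Tendsto (fun m : ℕ => (m : ℝ) ^ (-(s - d))) atTop (𝓝 0) :=
    (tendsto_rpow_neg_atTop (sub_pos.2 hs)).comp tendsto_natCast_atTop_atTop
  have h3 : Tendsto (fun m : ℕ => (1 + n / ((m : ℝ) ^ d * N)) * A +
      (1 + n / ((m : ℝ) ^ d * N)) ^ 2 * (N * B * (m : ℝ) ^ (-(s - d)))) atTop (𝓝 A) := by
    simpa using ((h1.const_add 1).mul_const A).add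
      (((h1.const_add 1).pow 2).mul (h2.const_mul (N * B)))
  filter_upwards [h3.eventually (gt_mem_nhds hAL), eventually_gt_atTop 0] with m hm hm0
  have hmR : (0 : ℝ) < m := by exact_mod_cast hm0
  have hpow : (m : ℝ) ^ (-s) = (m : ℝ) ^ (-(s - d)) / (m : ℝ) ^ d := by
    rw [← Real.rpow_natCast, ← Real.rpow_sub hmR]
    congr 1
    ring
  have hX : (0 : ℝ) < (m : ℝ) ^ d * N := by positivity
  calc _ = ((1 + n / ((m : ℝ) ^ d * N)) * A +
      (1 + n / ((m : ℝ) ^ d * N)) ^ 2 * (N * B * (m : ℝ) ^ (-(s - d)))) * ((m : ℝ) ^ d * N) := by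
        rw [hpow]
        field_simp
    _ ≤ _ := mul_le_mul_of_nonneg_right hm.le hX.le

theorem eventually_boxes_fit {d : ℕ} (hd : 0 < d) {α c θ : ℝ} (hα : 0 < α) (hθ0 : 0 ≤ θ)
    (hθ : 1 < α * θ ^ d) :
    ∀ᶠ u : ℝ in atTop, u ^ d / α + c ≤ (u * θ - 1) ^ d ∧ 0 ≤ u * θ - 1 := by
  have hθ' : 0 < θ := by
    rcases hθ0.eq_or_lt with h | h
    · rw [← h, zero_pow hd.ne'] at hθ
      linarith
    · exact h
  have h1 : Tendsto (fun u : ℝ => 1 / α + c / u ^ d) atTop (𝓝 (1 / α)) := by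
    simpa using (tendsto_const_nhds.div_atTop (tendsto_pow_atTop hd.ne')).const_add (1 / α)
  have h2 : Tendsto (fun u : ℝ => (θ - 1 / u) ^ d) atTop (𝓝 (θ ^ d)) := by
    have : Tendsto (fun u : ℝ => 1 / u) atTop (𝓝 0) := tendsto_const_nhds.div_atTop tendsto_id
    simpa using (this.const_sub θ).pow d
  have h3 : 1 / α < θ ^ d := by rwa [div_lt_iff₀' hα]
  filter_upwards [h1.eventually_lt h2 h3, eventually_gt_atTop 0,
    (tendsto_id.atTop_mul_const hθ').eventually (eventually_ge_atTop 1)] with u hu hu0 hu1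
  simp only [id] at hu1
  refine ⟨?_, by linarith⟩
  have hud : 0 < u ^ d := by positivity
  calc u ^ d / α + c = (1 / α + c / u ^ d) * u ^ d := by field_simp
    _ ≤ (θ - 1 / u) ^ d * u ^ d := mul_le_mul_of_nonneg_right hu.le hud.le
    _ = _ := by
      rw [← mul_pow]
      congr 1
      field_simp

/-- The number `M` of copies of a family of `c` boxes with `n` points in total that is needed for at
least `m ^ d * N` points, and the side `k` of the cube of boxes into which these copies fit. -/
theorem exists_multiplicity {d : ℕ} (hd : 0 < d) {m ℓ n c N : ℕ} (hnm : n < m) (hℓ : 0 < ℓ)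
    (hN : 0 < N) (hn : 0 < n) {α θ : ℝ} (hα : 0 < α) (hαn : α * (c * ((ℓ : ℝ) ^ d * N)) ≤ n)
    (hθ : 0 ≤ (m / ℓ : ℝ) * θ - 1) (hfit : (m / ℓ : ℝ) ^ d / α + c ≤ ((m / ℓ : ℝ) * θ - 1) ^ d) :
    ∃ M k : ℕ, (m : ℝ) ^ d * N ≤ M * n ∧ (M * n : ℝ) ≤ (m : ℝ) ^ d * N + n ∧ 2 ≤ M ∧
      (k : ℝ) ≤ (m / ℓ : ℝ) * θ ∧ c * M ≤ k ^ d := by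
  have hn0 : (0 : ℝ) < n := by exact_mod_cast hn
  have hℓR : (0 : ℝ) < ℓ := by exact_mod_cast hℓ
  have hM1 : (m : ℝ) ^ d * N ≤ ⌈(m : ℝ) ^ d * N / n⌉₊ * n := by
    have := Nat.le_ceil ((m : ℝ) ^ d * N / n)
    rwa [div_le_iff₀ hn0] at this
  have hM2 : (⌈(m : ℝ) ^ d * N / n⌉₊ : ℝ) < (m : ℝ) ^ d * N / n + 1 :=
    Nat.ceil_lt_add_one (by positivity)
  refine ⟨⌈(m : ℝ) ^ d * N / n⌉₊, ⌊(m / ℓ : ℝ) * θ⌋₊, hM1, ?_, ?_,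
    Nat.floor_le (by linarith), ?_⟩
  · have := mul_le_mul_of_nonneg_right hM2.le hn0.le
    rwa [add_mul, div_mul_cancel₀ _ hn0.ne', one_mul] at this
  · rw [Nat.succ_le_iff, Nat.lt_ceil, Nat.cast_one, one_lt_div hn0]
    have h1 : n < m ^ d * N := hnm.trans_le
      ((Nat.le_self_pow hd.ne' m).trans (Nat.le_mul_of_pos_right _ hN))
    exact_mod_cast h1
  · have h1 : (c : ℝ) * ⌈(m : ℝ) ^ d * N / n⌉₊ ≤ (m / ℓ : ℝ) ^ d / α + c := by
      have h2 : (c : ℝ) * ((m : ℝ) ^ d * N / n) ≤ (m / ℓ : ℝ) ^ d / α := by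
        rw [← mul_div_assoc, div_le_div_iff₀ hn0 hα, div_pow, div_mul_eq_mul_div,
          le_div_iff₀ (by positivity)]
        calc _ = (m : ℝ) ^ d * (α * (c * ((ℓ : ℝ) ^ d * N))) := by ring
          _ ≤ _ := by gcongr
      have h3 := mul_le_mul_of_nonneg_left hM2.le (Nat.cast_nonneg (α := ℝ) c)
      rw [mul_add, mul_one] at h3
      linarith
    have h3 : ((m / ℓ : ℝ) * θ - 1) ^ d ≤ (⌊(m / ℓ : ℝ) * θ⌋₊ : ℝ) ^ d := by
      gcongr
      exact (Nat.sub_one_lt_floor _).le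
    exact_mod_cast h1.trans (hfit.trans h3)

/-- A family of configurations in boxes with more points per box than `Λ` has, and the required
energy per point, yields configurations on all large tori with as many points as `Λ`. -/
theorem HasCellFamily.eventually_minEnergy_le {d : ℕ} (hd : 0 < d) {f : ℝ≥0 → ℝ≥0∞}
    {Λ : Submodule ℤ (Euc d)} [DiscreteTopology Λ] [IsZLattice ℝ Λ]
    {b : Module.Basis (Fin d) ℝ (Euc d)} (hΦ : IsSubZLattice (Submodule.span ℤ (Set.range b)) Λ)
    {q : ℕ} (hq : 0 < q) {s : ℝ} (hs : (d : ℝ) < s) {g : (Fin d → ℤ) → ℝ≥0∞}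
    (hg : (∑' n, g n) ≠ ∞) {ℓ₀ : ℕ}
    (hint : ∀ ℓ : ℕ, ℓ₀ ≤ ℓ → ∀ x ∈ subcell b q ℓ, ∀ y ∈ subcell b q ℓ, ∀ n : Fin d → ℤ, n ≠ 0 →
        radialPotential f (x - y + (ℓ : ℝ) • intVec b n) ≤ ENNReal.ofReal ((ℓ : ℝ) ^ (-s)) * g n)
    {ℓ : ℕ} (hℓ₀ : ℓ₀ ≤ ℓ) (hℓ : 0 < ℓ) {α β l L : ℝ} (hl : 0 ≤ l)
    (hfam : HasCellFamily f b q ℓ (cosetCount Λ ((ℓ : ℤ) • Submodule.span ℤ (Set.range b))) α β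
      (ENNReal.ofReal l))
    (hα : 1 < α * (1 - 1 / q : ℝ) ^ d)
    (hL : l + 2 * (β * cosetCount Λ ((ℓ : ℤ) • Submodule.span ℤ (Set.range b))) *
      ((ℓ : ℝ) ^ (-s) * (∑' n, g n).toReal) < L) :
    ∀ᶠ m : ℕ in atTop,
      minEnergy (periodizedPotential f ((m : ℤ) • Submodule.span ℤ (Set.range b)))
        (cosetCount Λ ((m : ℤ) • Submodule.span ℤ (Set.range b))) ≤
      ENNReal.ofReal L * cosetCount Λ ((m : ℤ) • Submodule.span ℤ (Set.range b)) := by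
  obtain ⟨J, _, _, I, _, X, hX, hαn, hnβ, hE⟩ := hfam
  set Nl := cosetCount Λ ((ℓ : ℤ) • Submodule.span ℤ (Set.range b)) with hNl
  set N := cosetCount Λ (Submodule.span ℤ (Set.range b)) with hN
  set n := ∑ j, Fintype.card (I j) with hn
  set c := Fintype.card J with hc
  set B := (∑' n, g n).toReal with hB
  have hBg : (∑' n, g n) = ENNReal.ofReal B := (ENNReal.ofReal_toReal hg).symm
  have hnR : ∑ j, (Fintype.card (I j) : ℝ) = n := by rw [hn]; push_cast; rfl
  have hnE : ∑ j, (Fintype.card (I j) : ℝ≥0∞) = ENNReal.ofReal n := by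
    rw [ENNReal.ofReal_natCast, hn]
    push_cast
    rfl
  rw [hnR] at hαn hnβ
  rw [hnE] at hE
  have hN0 : (0 : ℝ) < N := by exact_mod_cast cosetCount_pos hΦ
  have hNl0 : (0 : ℝ) < Nl := by exact_mod_cast cosetCount_pos (hΦ.smul hℓ)
  have hNlN : (Nl : ℝ) = (ℓ : ℝ) ^ d * N := by exact_mod_cast cosetCount_smul hΦ hℓ
  have hc0 : (0 : ℝ) < c := by exact_mod_cast Fintype.card_pos
  have hℓR : (0 : ℝ) < ℓ := by exact_mod_cast hℓ
  have hqR : (0 : ℝ) < q := by exact_mod_cast hq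
  have hθ0 : (0 : ℝ) ≤ 1 - 1 / q := by
    rw [sub_nonneg, div_le_one hqR]
    exact_mod_cast hq
  have hα0 : 0 < α := by
    by_contra h
    have := mul_nonpos_of_nonpos_of_nonneg (not_lt.1 h) (pow_nonneg hθ0 d)
    linarith
  have hn0 : (0 : ℝ) < n := lt_of_lt_of_le (by positivity) hαn
  have hβ0 : 0 < β := by
    by_contra h
    have := mul_nonpos_of_nonpos_of_nonneg (not_lt.1 h) (by positivity : 0 ≤ (c : ℝ) * Nl)
    linarith
  have hB0 : 0 ≤ B := ENNReal.toReal_nonneg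
  set A := l + 2 * (β * Nl) * ((ℓ : ℝ) ^ (-s) * B) with hA
  have hA0 : 0 ≤ A := by positivity
  filter_upwards [((tendsto_natCast_atTop_atTop (R := ℝ)).atTop_div_const hℓR).eventually
    (eventually_boxes_fit hd (c := c) hα0 hθ0 hα),
    eventually_torus_energy_le hd hs (B := B) (n := n) hN0 hL, eventually_ge_atTop ℓ₀,
    eventually_gt_atTop n] with m hm1 hm2 hm3 hm4
  obtain ⟨hfit, hfit0⟩ := hm1
  have hm0 : 0 < m := (Nat.zero_le n).trans_lt hm4
  have hmR : (0 : ℝ) < m := by exact_mod_cast hm0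
  have hNm : (cosetCount Λ ((m : ℤ) • Submodule.span ℤ (Set.range b)) : ℝ) = (m : ℝ) ^ d * N := by
    exact_mod_cast cosetCount_smul hΦ hm0
  obtain ⟨M, k, hM1, hM3, hM4, hfloor, hcMk⟩ := exists_multiplicity hd hm4 hℓ
    (cosetCount_pos hΦ) (by exact_mod_cast hn0) hα0
    (by rw [← hNlN]; exact hαn) hfit0 hfit
  have hcM : 2 ≤ c * M := hM4.trans (Nat.le_mul_of_pos_left M (by exact_mod_cast hc0))
  obtain ⟨W, _, w, hW, hwc, hwE⟩ := exists_assembly (hint ℓ hℓ₀) hX hcM hcMk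
  have hcell : ∀ i, w i ∈ subcell b q m := by
    intro i j
    refine ⟨(hwc i j).1, (hwc i j).2.trans_lt ?_⟩
    have h1 : (ℓ : ℝ) * k ≤ m * (1 - 1 / q) := by
      have := mul_le_mul_of_nonneg_left hfloor hℓR.le
      calc _ ≤ _ := this
        _ = _ := by field_simp
    have h2 : 0 < (ℓ : ℝ) * (1 / q) := by positivity
    rw [mul_sub (ℓ : ℝ)]
    linarith
  have hWR : (Fintype.card W : ℝ) = M * n := by exact_mod_cast hW
  have hWE : (Fintype.card W : ℝ≥0∞) = ENNReal.ofReal (M * n) := by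
    rw [← hWR, ENNReal.ofReal_natCast]
  -- the energy per point of the large box
  have hbox : configEnergy (radialPotential f) w ≤ ENNReal.ofReal (M * n * A) := by
    have hcM' : (((c * M - 1 : ℕ) : ℝ)) = c * M - 1 := by
      rw [Nat.cast_sub (by omega)]
      push_cast
      rfl
    have hcM2 : (2 : ℝ) ≤ c * M := by exact_mod_cast hcM
    refine hwE.trans ?_
    rw [hnE, hBg, ← ENNReal.ofReal_natCast (n := M), ← ENNReal.ofReal_natCast (n := c * M - 1), hcM',
      ← ENNReal.ofReal_mul (by positivity), ← ENNReal.ofReal_mul (by positivity),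
      ← ENNReal.ofReal_pow (by positivity), ← ENNReal.ofReal_mul (by positivity),
      ← ENNReal.ofReal_div_of_pos (by linarith)]
    rw [← ENNReal.ofReal_mul hl] at hE
    calc _ ≤ ENNReal.ofReal M * ENNReal.ofReal (l * n) +
          ENNReal.ofReal ((M * n) ^ 2 * ((ℓ : ℝ) ^ (-s) * B) / (c * M - 1)) := by gcongr
      _ = ENNReal.ofReal (M * (l * n) + (M * n) ^ 2 * ((ℓ : ℝ) ^ (-s) * B) / (c * M - 1)) := by
          rw [← ENNReal.ofReal_mul (by positivity), ENNReal.ofReal_add (by positivity)]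
          exact div_nonneg (by positivity) (by linarith)
      _ ≤ _ := by
          refine ENNReal.ofReal_le_ofReal ?_
          -- `c * M ≤ 2 * (c * M - 1)` turns the average over pairs of distinct boxes into `O(ℓ ^ d)`
          have h1 : (M : ℝ) * n ≤ 2 * (β * Nl) * (c * M - 1) := by
            have h2 : (M : ℝ) * n ≤ M * (β * (c * Nl)) := by gcongr
            have h3 : 0 ≤ β * Nl * (c * M - 2) := mul_nonneg (by positivity) (by linarith)
            linarith
          have h4 : (M * n : ℝ) ^ 2 * ((ℓ : ℝ) ^ (-s) * B) / (c * M - 1) ≤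
              M * n * (2 * (β * Nl) * ((ℓ : ℝ) ^ (-s) * B)) := by
            rw [div_le_iff₀ (by linarith)]
            calc (M * n : ℝ) ^ 2 * ((ℓ : ℝ) ^ (-s) * B)
                = M * n * ((ℓ : ℝ) ^ (-s) * B) * (M * n) := by ring
              _ ≤ M * n * ((ℓ : ℝ) ^ (-s) * B) * (2 * (β * Nl) * (c * M - 1)) := by gcongr
              _ = _ := by ring
          rw [hA]
          linarith
  have hcard : cosetCount Λ ((m : ℤ) • Submodule.span ℤ (Set.range b)) ≤ Fintype.card W := by
    have : (cosetCount Λ ((m : ℤ) • Submodule.span ℤ (Set.range b)) : ℝ) ≤ Fintype.card W := by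
      rw [hNm, hWR]
      exact hM1
    exact_mod_cast this
  refine (minEnergy_le_configEnergy _ w hcard).trans ((configEnergy_torus_le (hint m hm3) hcell).trans
    ((add_le_add_left hbox _).trans ?_))
  have hL0 : 0 ≤ L := hA0.trans hL.le
  rw [hWE, hBg, ← ENNReal.ofReal_natCast (n := cosetCount _ _), hNm,
    ← ENNReal.ofReal_mul (by positivity), ← ENNReal.ofReal_pow (by positivity),
    ← ENNReal.ofReal_mul (by positivity), ← ENNReal.ofReal_mul hL0,
    ← ENNReal.ofReal_add (by positivity) (by positivity)]
  refine ENNReal.ofReal_le_ofReal (le_trans ?_ hm2)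
  gcongr

theorem tendsto_one_sub_div (d : ℕ) :
    Tendsto (fun q : ℕ => (1 - d / q : ℝ)) atTop (𝓝 1) := by
  simpa using (tendsto_const_div_atTop_nhds_zero_nat (d : ℝ)).const_sub 1

theorem one_sub_div_le_pow {d q : ℕ} (hq : 0 < q) : (1 - d / q : ℝ) ≤ (1 - 1 / q : ℝ) ^ d := by
  have hqR : (1 : ℝ) ≤ q := by exact_mod_cast hq
  have h := one_add_mul_le_pow (a := -(1 / q : ℝ)) (by
    have : (1 / q : ℝ) ≤ 1 := by rw [div_le_one (by linarith)]; exact hqR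
    linarith) d
  calc (1 - d / q : ℝ) = 1 + d * -(1 / q) := by ring
    _ ≤ _ := h

/-- On all large tori there is a configuration with as many points as `Λ` and finite energy. -/
theorem eventually_minEnergy_ne_top {d : ℕ} (hd : 0 < d) {f : ℝ≥0 → ℝ≥0∞} (hf : HasRapidDecay d f)
    {Λ Φ : Submodule ℤ (Euc d)} [DiscreteTopology Λ] [IsZLattice ℝ Λ] {ρ : ℝ} (hρ : 0 < ρ)
    (hΛ : HasDensity (latticeConfig Λ) ρ) (hΦ : IsSubZLattice Φ Λ)
    {κ : Type} {z : κ → Euc d} {ρ' : ℝ} (hρ' : ρ < ρ') (hz : IsInfiniteConfig z)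
    (hzρ : HasDensity z ρ') (hzf : lowerEnergy f z < ∞) :
    ∀ᶠ m : ℕ in atTop,
      minEnergy (periodizedPotential f ((m : ℤ) • Φ)) (cosetCount Λ ((m : ℤ) • Φ)) ≠ ∞ := by
  obtain ⟨b, rfl⟩ : ∃ b : Module.Basis (Fin d) ℝ (Euc d), Submodule.span ℤ (Set.range b) = Φ := by
    obtain ⟨-, _, _⟩ := hΦ
    exact exists_basis_span Φ
  obtain ⟨l, hl0, hl, -⟩ := ENNReal.lt_iff_exists_real_btwn.1 hzf
  set γ := ρ' / ρ with hγ
  have hγ1 : 1 < γ := by rwa [hγ, lt_div_iff₀ hρ, one_mul]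
  have hlim : Tendsto (fun q : ℕ => (1 - d / q : ℝ) ^ 3 * γ) atTop (𝓝 γ) := by
    simpa using ((tendsto_one_sub_div d).pow 3).mul_const γ
  obtain ⟨q, hq1, hq⟩ := ((hlim.eventually (lt_mem_nhds hγ1)).and (eventually_gt_atTop d)).exists
  have hq0 : 0 < q := (Nat.zero_le d).trans_lt hq
  have hqR : (0 : ℝ) < q := by exact_mod_cast hq0
  set θ : ℝ := 1 - d / q with hθ
  have hθ0 : 0 < θ := by
    rw [hθ, sub_pos, div_lt_one hqR]
    exact_mod_cast hq
  have hθ1 : θ < 1 := by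
    rw [hθ, sub_lt_self_iff]
    have : (0 : ℝ) < d := by exact_mod_cast hd
    positivity
  obtain ⟨s, hs, g, hg, ℓ, hℓ, hint⟩ : ∃ s : ℝ, (d : ℝ) < s ∧ ∃ g : (Fin d → ℤ) → ℝ≥0∞,
      (∑' n, g n) ≠ ∞ ∧ ∃ ℓ₀ : ℕ, 0 < ℓ₀ ∧
      ∀ ℓ : ℕ, ℓ₀ ≤ ℓ → ∀ x ∈ subcell b q ℓ, ∀ y ∈ subcell b q ℓ, ∀ n : Fin d → ℤ, n ≠ 0 →
        radialPotential f (x - y + (ℓ : ℝ) • intVec b n) ≤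
          ENNReal.ofReal ((ℓ : ℝ) ^ (-s)) * g n := by
    obtain ⟨-, _, _⟩ := hΦ
    exact exists_interaction_bound hf b rfl hq0
  have hfam := hasCellFamily_of_lowerEnergy_lt hρ hΛ b hΦ (hρ.trans hρ') hz hzρ hl hq hℓ
    (α := θ ^ 2 * γ) (β := 2 * γ) (by
      rw [← hθ, ← hγ, sq, mul_assoc]
      exact mul_lt_mul_of_pos_left (mul_lt_of_lt_one_left (by linarith) hθ1) hθ0) (by linarith)
  rw [← hθ, ← ENNReal.ofReal_div_of_pos hθ0] at hfam
  have h1 : 1 < θ ^ 2 * γ * (1 - 1 / q : ℝ) ^ d := by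
    refine hq1.trans_le ?_
    calc θ ^ 3 * γ = θ ^ 2 * γ * θ := by ring
      _ ≤ _ := by
        gcongr
        exact one_sub_div_le_pow hq0
  filter_upwards [hfam.eventually_minEnergy_le hd hΦ hq0 hs hg hint le_rfl hℓ
    (div_nonneg hl0 hθ0.le) h1 (lt_add_one _)] with m hm
  exact ne_top_of_le_ne_top (ENNReal.mul_ne_top ENNReal.ofReal_ne_top (by simp)) hm

/-- The energy of an infinite configuration of the density of `Λ` can be approximately attained on
all large tori, by configurations with exactly as many points as `Λ`. The points lost in the gaps
between the boxes are made up for by a small number of boxes filled from a configuration of larger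
density. -/
theorem eventually_minEnergy_le {d : ℕ} (hd : 0 < d) {f : ℝ≥0 → ℝ≥0∞} (hf : HasRapidDecay d f)
    {Λ Φ : Submodule ℤ (Euc d)} [DiscreteTopology Λ] [IsZLattice ℝ Λ] {ρ : ℝ} (hρ : 0 < ρ)
    (hΛ : HasDensity (latticeConfig Λ) ρ) (hΦ : IsSubZLattice Φ Λ)
    {κ' : Type} {y : κ' → Euc d} (hy : IsInfiniteConfig y) (hyρ : HasDensity y ρ) {L : ℝ}
    (hyL : lowerEnergy f y < ENNReal.ofReal L)
    {κ : Type} {z : κ → Euc d} {ρ' : ℝ} (hρ' : ρ < ρ') (hz : IsInfiniteConfig z)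
    (hzρ : HasDensity z ρ') (hzf : lowerEnergy f z < ∞) :
    ∀ᶠ m : ℕ in atTop,
      minEnergy (periodizedPotential f ((m : ℤ) • Φ)) (cosetCount Λ ((m : ℤ) • Φ)) ≤
        ENNReal.ofReal L * cosetCount Λ ((m : ℤ) • Φ) := by
  obtain ⟨b, rfl⟩ : ∃ b : Module.Basis (Fin d) ℝ (Euc d), Submodule.span ℤ (Set.range b) = Φ := by
    obtain ⟨-, _, _⟩ := hΦ
    exact exists_basis_span Φ
  obtain ⟨l₁, hl₁0, hl₁, hl₁L⟩ := ENNReal.lt_iff_exists_real_btwn.1 hyL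
  obtain ⟨l₂, hl₂0, hl₂, -⟩ := ENNReal.lt_iff_exists_real_btwn.1 hzf
  replace hl₁L : l₁ < L := (ENNReal.ofReal_lt_ofReal_iff_of_nonneg hl₁0).1 hl₁L
  set γ := ρ' / ρ with hγ
  have hγ1 : 1 < γ := by rwa [hγ, lt_div_iff₀ hρ, one_mul]
  set l := (l₁ + L) / 2 with hl
  have hll : l₁ < l := by rw [hl]; linarith
  have hlL : l < L := by rw [hl]; linarith
  -- one box of larger density is used for `a` boxes of the density of `Λ`, with `a` so large that
  -- the average energy stays below `l`
  obtain ⟨a, ha⟩ := exists_nat_gt (2 * γ * l₂ / (l - l₁))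
  rw [div_lt_iff₀ (sub_pos.2 hll)] at ha
  have haR : (0 : ℝ) ≤ a := Nat.cast_nonneg a
  -- the three conditions on `q` hold in the limit `q → ∞`
  have hlim1 : Tendsto (fun q : ℕ => (1 - d / q : ℝ) ^ 3 * ((a + γ) / (a + 1))) atTop
      (𝓝 ((a + γ) / (a + 1))) := by
    simpa using ((tendsto_one_sub_div d).pow 3).mul_const ((a + γ) / (a + 1))
  have hlim2 : Tendsto (fun q : ℕ => l₁ / (1 - d / q : ℝ)) atTop (𝓝 l₁) := by
    simpa [Pi.div_def] using
      (tendsto_const_nhds (x := l₁)).div (tendsto_one_sub_div d) one_ne_zero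
  have hlim3 : Tendsto (fun q : ℕ => 2 * γ * (l₂ / (1 - d / q : ℝ))) atTop (𝓝 (2 * γ * l₂)) := by
    simpa [Pi.div_def] using ((tendsto_const_nhds (x := l₂)).div
      (tendsto_one_sub_div d) one_ne_zero).const_mul (2 * γ)
  have hlim4 : Tendsto (fun q : ℕ => (l - l₁ / (1 - d / q : ℝ)) * a * (1 - d / q : ℝ) ^ 2) atTop
      (𝓝 ((l - l₁) * a)) := by
    simpa using ((hlim2.const_sub l).mul_const (a : ℝ)).mul ((tendsto_one_sub_div d).pow 2)
  have hag : (1 : ℝ) < (a + γ) / (a + 1) := by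
    rw [lt_div_iff₀ (by positivity)]
    linarith
  obtain ⟨q, hq1, hq2, hq3, hq⟩ := ((hlim1.eventually (lt_mem_nhds hag)).and
    ((hlim2.eventually (gt_mem_nhds hll)).and ((hlim3.eventually_lt hlim4 (by linarith)).and
      (eventually_gt_atTop d)))).exists
  have hq0 : 0 < q := (Nat.zero_le d).trans_lt hq
  have hqR : (0 : ℝ) < q := by exact_mod_cast hq0
  set θ : ℝ := 1 - d / q with hθ
  have hθ0 : 0 < θ := by
    rw [hθ, sub_pos, div_lt_one hqR]
    exact_mod_cast hq
  have hθ1 : θ < 1 := by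
    rw [hθ, sub_lt_self_iff]
    have : (0 : ℝ) < d := by exact_mod_cast hd
    positivity
  obtain ⟨s, hs, g, hg, ℓ₀, hℓ₀, hint⟩ : ∃ s : ℝ, (d : ℝ) < s ∧ ∃ g : (Fin d → ℤ) → ℝ≥0∞,
      (∑' n, g n) ≠ ∞ ∧ ∃ ℓ₀ : ℕ, 0 < ℓ₀ ∧
      ∀ ℓ : ℕ, ℓ₀ ≤ ℓ → ∀ x ∈ subcell b q ℓ, ∀ y ∈ subcell b q ℓ, ∀ n : Fin d → ℤ, n ≠ 0 →
        radialPotential f (x - y + (ℓ : ℝ) • intVec b n) ≤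
          ENNReal.ofReal ((ℓ : ℝ) ^ (-s)) * g n := by
    obtain ⟨-, _, _⟩ := hΦ
    exact exists_interaction_bound hf b rfl hq0
  set β := (a * 2 + 2 * γ) / (a + 1) with hβ
  set N := cosetCount Λ (Submodule.span ℤ (Set.range b)) with hN
  set B := (∑' n, g n).toReal with hB
  have hlim5 : Tendsto (fun ℓ : ℕ => l + 2 * (β * N) * B * (ℓ : ℝ) ^ (-(s - d))) atTop (𝓝 l) := by
    have : Tendsto (fun m : ℕ => (m : ℝ) ^ (-(s - d))) atTop (𝓝 0) :=
      (tendsto_rpow_neg_atTop (sub_pos.2 hs)).comp tendsto_natCast_atTop_atTop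
    simpa using (this.const_mul (2 * (β * N) * B)).const_add l
  obtain ⟨ℓ, hℓL, hℓ⟩ := ((hlim5.eventually (gt_mem_nhds hlL)).and
    (eventually_ge_atTop ℓ₀)).exists
  have hℓ0 : 0 < ℓ := hℓ₀.trans_le hℓ
  have hℓR : (0 : ℝ) < ℓ := by exact_mod_cast hℓ0
  -- the exponent of `θ` is one larger than that of the proportion of points kept, as the lower bound
  -- `α` has to be strict
  have hfam₁ := hasCellFamily_of_lowerEnergy_lt hρ hΛ b hΦ hρ hy hyρ hl₁ hq hℓ0
    (α := θ ^ 2) (β := 2) (by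
      rw [← hθ, div_self hρ.ne', mul_one, sq]
      exact mul_lt_of_lt_one_left hθ0 hθ1) (by rw [div_self hρ.ne']; norm_num)
  have hfam₂ := hasCellFamily_of_lowerEnergy_lt hρ hΛ b hΦ (hρ.trans hρ') hz hzρ hl₂ hq hℓ0
    (α := θ ^ 2 * γ) (β := 2 * γ) (by
      rw [← hθ, ← hγ, sq, mul_assoc]
      exact mul_lt_mul_of_pos_left (mul_lt_of_lt_one_left (by linarith) hθ1) hθ0) (by linarith)
  rw [← hθ, ← ENNReal.ofReal_div_of_pos hθ0] at hfam₁ hfam₂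
  have hfam := hfam₁.mix hfam₂ a (div_nonneg hl₁0 hθ0.le) (div_nonneg hl₂0 hθ0.le) hq2.le hq3.le
  refine hfam.eventually_minEnergy_le hd hΦ hq0 hs hg hint hℓ hℓ0 (hl₁0.trans hll.le) ?_ ?_
  · refine hq1.trans_le ?_
    calc θ ^ 3 * ((a + γ) / (a + 1)) = (a * θ ^ 2 + θ ^ 2 * γ) / (a + 1) * θ := by ring
      _ ≤ _ := by
        gcongr
        exact one_sub_div_le_pow hq0
  · refine lt_of_eq_of_lt ?_ hℓL
    have h1 : (cosetCount Λ ((ℓ : ℤ) • Submodule.span ℤ (Set.range b)) : ℝ) = (ℓ : ℝ) ^ d * N := by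
      exact_mod_cast cosetCount_smul hΦ hℓ0
    have hpow : (ℓ : ℝ) ^ (-(s - d)) = (ℓ : ℝ) ^ d * (ℓ : ℝ) ^ (-s) := by
      rw [← Real.rpow_natCast, ← Real.rpow_add hℓR]
      congr 1
      ring
    rw [h1, hpow]
    ring

/-! ### Optimality of lattices -/

theorem eventually_latticeSum_smul_ne_top {d : ℕ} {f : ℝ≥0 → ℝ≥0∞} (hf : HasRapidDecay d f)
    (Λ : Submodule ℤ (Euc d)) [DiscreteTopology Λ] [IsZLattice ℝ Λ] :
    ∀ᶠ m : ℕ in atTop, latticeSum f ((m : ℤ) • Λ) ≠ ∞ := by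
  obtain ⟨b, hb⟩ := exists_basis_span Λ
  obtain ⟨s, -, g, hg, ℓ₀, -, hint⟩ := exists_interaction_bound hf b hb two_pos
  filter_upwards [eventually_ge_atTop ℓ₀, eventually_gt_atTop 0] with m hm hm0
  have hmR : (0 : ℝ) < m := by exact_mod_cast hm0
  have h0 : (0 : Euc d) ∈ subcell b 2 m := fun i => by
    simp only [map_zero, Finsupp.coe_zero, Pi.zero_apply, le_refl, true_and]
    norm_num [hmR]
  have h := tsum_torus_images_le (hint m hm) h0 h0
  rw [hb] at h
  refine ne_top_of_le_ne_top (ENNReal.mul_ne_top ENNReal.ofReal_ne_top hg) (le_trans ?_ h)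
  simp [latticeSum]

/-- A lattice that is optimal has finite energy, because there are periodic configurations of the
same density with finite energy. -/
theorem IsOptimalOfDensity.latticeSum_ne_top {d : ℕ} (hd : 0 < d) {f : ℝ≥0 → ℝ≥0∞}
    (hf : HasRapidDecay d f) {Λ : Submodule ℤ (Euc d)} [DiscreteTopology Λ] [IsZLattice ℝ Λ] {ρ : ℝ}
    (hρ : 0 < ρ) (hΛ : HasDensity (latticeConfig Λ) ρ)
    (hopt : IsOptimalOfDensity f ρ (latticeConfig Λ))
    {κ : Type} {z : κ → Euc d} {ρ' : ℝ} (hρ' : ρ < ρ') (hz : IsInfiniteConfig z)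
    (hzρ : HasDensity z ρ') (hzf : lowerEnergy f z < ∞) : latticeSum f Λ ≠ ∞ := by
  have hself : IsSubZLattice Λ Λ := ⟨le_rfl, inferInstance, inferInstance⟩
  obtain ⟨m, hm1, hm2, hm3⟩ := ((eventually_minEnergy_ne_top hd hf hρ hΛ hself hρ' hz hzρ hzf).and
    ((eventually_latticeSum_smul_ne_top hf Λ).and (eventually_gt_atTop 0))).exists
  obtain ⟨y, hy⟩ := iInf_lt_iff.1 (lt_top_iff_ne_top.2 hm1)
  have hsub := hself.smul hm3
  have hdens := hasDensity_sublattice hΛ hsub (isFundDomain_range_out _)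
  have hN : 0 < cosetCount Λ ((m : ℤ) • Λ) := cosetCount_pos hsub
  have hNR : (0 : ℝ) < cosetCount Λ ((m : ℤ) • Λ) := by exact_mod_cast hN
  have : Nonempty (Fin (cosetCount Λ ((m : ℤ) • Λ))) := ⟨⟨0, hN⟩⟩
  obtain ⟨-, _, _⟩ := hsub
  obtain ⟨-, -, e, he, hmin⟩ := hopt
  obtain rfl := tendsto_nhds_unique he (tendsto_energyPerPoint_latticeConfig f Λ hρ hΛ)
  have h1 := hmin _ (periodicConfig y ((m : ℤ) • Λ)) (isInfiniteConfig_periodicConfig hd y _) (by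
    have := hdens.periodicConfig y
    rwa [Fintype.card_fin, ← cosetCount, mul_div_cancel₀ _ hNR.ne'] at this)
  have h2 := h1.trans (lowerEnergy_periodicConfig_le f _ (div_pos hρ hNR) hdens y)
  refine ne_top_of_le_ne_top (ENNReal.div_ne_top (ENNReal.add_ne_top.2
    ⟨hy.ne, ENNReal.mul_ne_top (by simp) hm2⟩) ?_) h2
  simpa using hN.ne'

theorem eventually_notMem_smul {d : ℕ} {Φ Λ : Submodule ℤ (Euc d)} (hΦ : IsSubZLattice Φ Λ)
    {v : Euc d} (hv : v ≠ 0) : ∀ᶠ m : ℕ in atTop, v ∉ ((m : ℤ) • Φ) := by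
  obtain ⟨b, rfl⟩ : ∃ b : Module.Basis (Fin d) ℝ (Euc d), Submodule.span ℤ (Set.range b) = Φ := by
    obtain ⟨-, _, _⟩ := hΦ
    exact exists_basis_span Φ
  obtain ⟨i, hi⟩ : ∃ i, b.repr v i ≠ 0 := by
    by_contra! h
    exact hv (b.ext_elem fun i => by simp [h i])
  filter_upwards [tendsto_natCast_atTop_atTop.eventually (eventually_gt_atTop |b.repr v i|)]
    with m hm hmem
  obtain ⟨n, rfl⟩ := (mem_smul_span_iff b m v).1 hmem
  simp only [map_smul, Finsupp.coe_smul, Pi.smul_apply, repr_intVec, smul_eq_mul] at hi hm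
  have hn : n i ≠ 0 := fun h => hi (by simp [h])
  have h1 : (1 : ℝ) ≤ |(n i : ℝ)| := by exact_mod_cast Int.one_le_abs hn
  rw [abs_mul, Nat.abs_cast] at hm
  nlinarith [(Nat.cast_nonneg m : (0 : ℝ) ≤ m)]

/-- If some configuration had less energy than `Λ`, then, for all large `m`, so would one on the torus
`ℝ ^ d / mΦ`, since a finite part of the sum defining `latticeSum f Λ` involves no vectors of
`mΦ`. -/
theorem isOptimalOfDensity_of_infinite {d : ℕ} (hd : 0 < d) {f : ℝ≥0 → ℝ≥0∞}
    (hf : HasRapidDecay d f) {Φ Λ : Submodule ℤ (Euc d)} [DiscreteTopology Λ] [IsZLattice ℝ Λ]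
    {ρ : ℝ} (hρ : 0 < ρ) (hΛ : HasDensity (latticeConfig Λ) ρ) (hΦ : IsSubZLattice Φ Λ)
    (hinf : {m : ℕ | 0 < m ∧ IsPeriodicOptimal f Λ ((m : ℤ) • Φ)}.Infinite)
    {κ : Type} {z : κ → Euc d} {ρ' : ℝ} (hρ' : ρ < ρ') (hz : IsInfiniteConfig z)
    (hzρ : HasDensity z ρ') (hzf : lowerEnergy f z < ∞) :
    IsOptimalOfDensity f ρ (latticeConfig Λ) := by
  classical
  refine ⟨isInfiniteConfig_latticeConfig hd Λ, hΛ, _,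
    tendsto_energyPerPoint_latticeConfig f Λ hρ hΛ, fun κ' y hy hyρ => ?_⟩
  by_contra! hlt
  obtain ⟨L, -, hL1, hL2⟩ := ENNReal.lt_iff_exists_real_btwn.1 hlt
  rw [latticeSum, ENNReal.tsum_eq_iSup_sum] at hL2
  obtain ⟨T, hT⟩ := lt_iSup_iff.1 hL2
  have hTm : ∀ᶠ m : ℕ in atTop, ∀ v ∈ T, v ≠ 0 → (v : Euc d) ∉ ((m : ℤ) • Φ) := by
    refine (Filter.eventually_all_finset T).2 fun v _ => ?_
    by_cases hv : v = 0
    · simp [hv]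
    · filter_upwards [eventually_notMem_smul hΦ (v := (v : Euc d)) (by simpa using hv)] with m hm _
      exact hm
  obtain ⟨m, ⟨hm0, hm1⟩, hm2, hm3⟩ := ((Nat.frequently_atTop_iff_infinite.2 hinf).and_eventually
    ((eventually_minEnergy_le hd hf hρ hΛ hΦ hy hyρ hL1 hρ' hz hzρ hzf).and hTm)).exists
  have hsub := hΦ.smul hm0
  have hΩ := isFundDomain_range_out ((m : ℤ) • Φ)
  obtain ⟨_, hE⟩ := hm1 _ hΩ
  rw [configEnergy_inter_fundDomain f hΩ hsub.1, ← cosetCount] at hE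
  rw [← hE, mul_comm, ENNReal.mul_le_mul_iff_left (by
    exact_mod_cast (cosetCount_pos hsub).ne') (by simp)] at hm2
  refine (hT.trans_le (le_trans ?_ hm2)).false
  refine le_trans (Finset.sum_le_sum fun v hv => ?_) (ENNReal.sum_le_tsum T)
  by_cases h : v = 0
  · simp [h]
  · simp [h, hm3 v hv h]

/-! ### Gaussian potentials -/

theorem gaussian_le_rpow {a : ℝ} (ha : 0 < a) (n : ℕ) {r : ℝ} (hr : 0 < r) :
    Real.exp (-a * r ^ 2) ≤ n.factorial / a ^ n * r ^ (-(2 * n : ℝ)) := by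
  have h := Real.pow_div_factorial_le_exp (a * r ^ 2) (by positivity) n
  have h2 : r ^ (-(2 * n : ℝ)) = ((r ^ 2) ^ n)⁻¹ := by
    rw [Real.rpow_neg hr.le, ← pow_mul]
    congr 1
    exact_mod_cast Real.rpow_natCast r (2 * n)
  rw [neg_mul, Real.exp_neg, h2]
  calc _ ≤ ((a * r ^ 2) ^ n / n.factorial)⁻¹ := by gcongr
    _ = _ := by
      rw [mul_pow]
      field_simp

theorem hasRapidDecay_gaussianPotential (d : ℕ) {a : ℝ} (ha : 0 < a) :
    HasRapidDecay d (gaussianPotential a) := by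
  refine ⟨2 * (d + 1 : ℕ), by push_cast; linarith [(Nat.cast_nonneg d : (0 : ℝ) ≤ d)],
    ((d + 1).factorial / a ^ (d + 1)).toNNReal, ?_⟩
  filter_upwards [eventually_gt_atTop 0] with r hr
  rw [gaussianPotential, ← ENNReal.ofReal_coe_nnreal]
  refine ENNReal.ofReal_le_ofReal ?_
  push_cast
  rw [Real.coe_toNNReal _ (by positivity)]
  exact_mod_cast gaussian_le_rpow ha (d + 1) hr

theorem latticeSum_gaussianPotential_ne_top {d : ℕ} {a : ℝ} (ha : 0 < a)
    (Λ : Submodule ℤ (Euc d)) [DiscreteTopology Λ] [IsZLattice ℝ Λ] :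
    latticeSum (gaussianPotential a) Λ ≠ ∞ := by
  have hsum := (ZLattice.summable_norm_rpow (L := Λ) (-(2 * (d + 1 : ℕ) : ℝ)) (by
    rw [ZLattice.rank ℝ Λ, finrank_euclideanSpace_fin]
    push_cast
    linarith [(Nat.cast_nonneg d : (0 : ℝ) ≤ d)])).mul_left
    ((d + 1).factorial / a ^ (d + 1) : ℝ)
  refine ne_top_of_le_ne_top hsum.tsum_ofReal_ne_top (ENNReal.tsum_le_tsum fun v => ?_)
  split_ifs with h
  · exact zero_le
  · exact ENNReal.ofReal_le_ofReal (gaussian_le_rpow ha (d + 1) (norm_pos_iff.2 (by simpa using h)))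

/-- Doubling every point of a lattice gives a configuration of twice the density with finite
Gaussian energy. -/
theorem lowerEnergy_gaussianPotential_double_lt_top {d : ℕ} {a : ℝ} (ha : 0 < a)
    {Λ : Submodule ℤ (Euc d)} [DiscreteTopology Λ] [IsZLattice ℝ Λ] {ρ : ℝ} (hρ : 0 < ρ)
    (hΛ : HasDensity (latticeConfig Λ) ρ) :
    lowerEnergy (gaussianPotential a) (periodicConfig (fun _ : Fin 2 => (0 : Euc d)) Λ) < ∞ := by
  classical
  refine (lowerEnergy_periodicConfig_le _ Λ hρ hΛ _).trans_lt ?_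
  have hS := latticeSum_gaussianPotential_ne_top ha Λ
  have hF : periodizedPotential (gaussianPotential a) Λ (0 : Euc d) ≠ ∞ := by
    rw [periodizedPotential, ENNReal.tsum_eq_add_tsum_ite (0 : Λ)]
    refine ENNReal.add_ne_top.2 ⟨ENNReal.ofReal_ne_top, ?_⟩
    simpa [latticeSum, radialPotential] using hS
  refine lt_top_iff_ne_top.2 (ENNReal.div_ne_top (ENNReal.add_ne_top.2
    ⟨?_, ENNReal.mul_ne_top (by simp) hS⟩) (by simp))
  rw [configEnergy_eq, tsum_fintype]
  refine ENNReal.sum_ne_top.2 fun i _ => ?_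
  rw [tsum_fintype]
  refine ENNReal.sum_ne_top.2 fun j _ => ?_
  split_ifs
  · simp
  · rwa [sub_zero]

theorem mainTheorem2 (d : ℕ) (hd : 0 < d)
    (Λ : Submodule ℤ (Euc d)) [DiscreteTopology Λ] [IsZLattice ℝ Λ]
    (ρ : ℝ) (hρ : 0 < ρ) (hΛρ : HasDensity (latticeConfig Λ) ρ) :
    (∀ f : ℝ≥0 → ℝ≥0∞, LowerSemicontinuous f → HasRapidDecay d f →
      (∃ (κ : Type) (y : κ → Euc d) (ρ' : ℝ), IsInfiniteConfig y ∧ ρ < ρ' ∧ HasDensity y ρ' ∧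
        lowerEnergy f y < ∞) →
      List.TFAE [
        IsOptimalOfDensity f ρ (latticeConfig Λ),
        ∀ Φ : Submodule ℤ (Euc d), IsSubZLattice Φ Λ → IsPeriodicOptimal f Λ Φ,
        ∃ Φ : Submodule ℤ (Euc d), IsSubZLattice Φ Λ ∧
          {m : ℕ | 0 < m ∧ IsPeriodicOptimal f Λ ((m : ℤ) • Φ)}.Infinite]) ∧
    (IsPeriodicUniversallyOptimal Λ ↔ IsUniversallyOptimalOfDensity ρ (latticeConfig Λ)) := by
  have hself : IsSubZLattice Λ Λ := ⟨le_rfl, inferInstance, inferInstance⟩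
  have hA : ∀ f : ℝ≥0 → ℝ≥0∞, LowerSemicontinuous f → HasRapidDecay d f →
      (∃ (κ : Type) (y : κ → Euc d) (ρ' : ℝ), IsInfiniteConfig y ∧ ρ < ρ' ∧ HasDensity y ρ' ∧
        lowerEnergy f y < ∞) →
      List.TFAE [
        IsOptimalOfDensity f ρ (latticeConfig Λ),
        ∀ Φ : Submodule ℤ (Euc d), IsSubZLattice Φ Λ → IsPeriodicOptimal f Λ Φ,
        ∃ Φ : Submodule ℤ (Euc d), IsSubZLattice Φ Λ ∧
          {m : ℕ | 0 < m ∧ IsPeriodicOptimal f Λ ((m : ℤ) • Φ)}.Infinite] := by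
    rintro f - hf ⟨κ, z, ρ', hz, hρ', hzρ, hzf⟩
    tfae_have 1 → 2 := fun h Φ hΦ =>
      h.isPeriodicOptimal hd hρ hΛρ (h.latticeSum_ne_top hd hf hρ hΛρ hρ' hz hzρ hzf) hΦ
    tfae_have 2 → 3 := fun h => ⟨Λ, hself,
      (Set.Ioi_infinite 0).mono fun m hm => ⟨hm, h _ (hself.smul hm)⟩⟩
    tfae_have 3 → 1 := fun ⟨Φ, hΦ, hinf⟩ =>
      isOptimalOfDensity_of_infinite hd hf hρ hΛρ hΦ hinf hρ' hz hzρ hzf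
    tfae_finish
  refine ⟨hA, ?_⟩
  have hB : ∀ a : ℝ, 0 < a → (IsOptimalOfDensity (gaussianPotential a) ρ (latticeConfig Λ) ↔
      ∀ Φ : Submodule ℤ (Euc d), IsSubZLattice Φ Λ →
        IsPeriodicOptimal (gaussianPotential a) Λ Φ) := by
    intro a ha
    refine (hA (gaussianPotential a) ?_ (hasRapidDecay_gaussianPotential d ha)
      ⟨_, periodicConfig (fun _ : Fin 2 => (0 : Euc d)) Λ, Fintype.card (Fin 2) * ρ,
        isInfiniteConfig_periodicConfig hd _ Λ, ?_, hΛρ.periodicConfig _,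
        lowerEnergy_gaussianPotential_double_lt_top ha hρ hΛρ⟩).out 0 1
    · refine Continuous.lowerSemicontinuous ?_
      exact ENNReal.continuous_ofReal.comp
        (Real.continuous_exp.comp (continuous_const.mul NNReal.continuous_coe))
    · simp only [Fintype.card_fin, Nat.cast_ofNat]
      linarith
  exact ⟨fun h a ha => (hB a ha).2 fun Φ hΦ => h Φ hΦ a ha,
    fun h Φ hΦ a ha => (hB a ha).1 (h a ha) Φ hΦ⟩
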